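/- Let $d,r\ge 1$ and let $\mathbf x$ be uniformly distributed on the sphere $\mathbb S^{d-1}(\sqrt d)=\{\mathbf x\in\mathbb R^d:\|\mathbf x\|_2=\sqrt d\}$. Let $\mathbf A_1,\dots,\mathbf A_r\in\mathbb R^{d\times d}$ and $\kappa_1\in\mathbb R$ be such that for all $i,j\in\{1,\dots,r\}$ $$\mathbb E\big[\mathbf x^{\top}\mathbf A_i\mathbf x\big]=0,\qquad \mathbb E\big[(\mathbf x^{\top}\mathbf A_i\mathbf x)(\mathbf x^{\top}\mathbf A_j\mathbf x)\big]=\delta_{ij},\qquad \|\mathbf A_i\|_{\rm op}\le\frac{\kappa_1}{\sqrt d}.$$ For probability measures $\mu,\nu$ on $\mathbb R^n$ with finite first moments let $W_1(\mu,\nu)=\sup_f\left|\int f\,d\mu-\int f\,d\nu\right|$ be the Wasserstein-1 distance, the supremum being over all $f:\mathbb R^n\to\mathbb R$ that are 1-Lipschitz for the Euclidean norm. Then there is an absolute constant $C>0$ (independent of $d,r,\kappa_1,\mathbf A_1,\dots,\mathbf A_r$, and of $s,\mathbf u_1,\dots,\mathbf u_s$ below) such that $$W_1\Big(\mathrm{Law}\big(\mathbf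 x^{\top}\mathbf A_1\mathbf x,\dots,\mathbf x^{\top}\mathbf A_r\mathbf x\big),\ \mathcal N(\mathbf 0_r,\mathbf I_r)\Big)\le C\,\frac{r^2\kappa_1}{\sqrt d}.$$ Moreover, for every $s\ge 0$ and all orthonormal vectors $\mathbf u_1,\dots,\mathbf u_s\in\mathbb R^d$, $$W_1\Big(\mathrm{Law}\big(\mathbf x^{\top}\mathbf A_1\mathbf x,\dots,\mathbf x^{\top}\mathbf A_r\mathbf x,\mathbf u_1^{\top}\mathbf x,\dots,\mathbf u_s^{\top}\mathbf x\big),\ \mathcal N(\mathbf 0_{r+s},\mathbf I_{r+s})\Big)\le C\,\frac{(r+s)^2\kappa_1}{\sqrt d}.$$ -/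

import Mathlib

open MeasureTheory ProbabilityTheory
open scoped Matrix ENNReal

noncomputable section

/-- The uniform distribution on the sphere of radius `√d` centred at the origin of `ℝᵈ`: the surface
measure of the unit sphere, normalised to total mass one and pushed forward by `x ↦ √d • x`. -/
def unifSphere (d : ℕ) : Measure (EuclideanSpace ℝ (Fin d)) :=
  (((volume : Measure (EuclideanSpace ℝ (Fin d))).toSphere Set.univ)⁻¹ •
    (volume : Measure (EuclideanSpace ℝ (Fin d))).toSphere).map
    (fun x : Metric.sphere (0 : EuclideanSpace ℝ (Fin d)) 1 =>
      Real.sqrt d • (x : EuclideanSpace ℝ (Fin d)))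

/-- The Wasserstein-1 distance with respect to the Euclidean norm, as the supremum of
`|∫ f dμ - ∫ f dν|` over the 1-Lipschitz functions `f`. The value lies in `[0, ∞]`.
The integrability clauses hold for every 1-Lipschitz `f` as soon as `μ` and `ν` are probability
measures with finite first moments; they only serve to keep out meaningless integrals. -/
def wasserstein1 {n : ℕ} (μ ν : Measure (EuclideanSpace ℝ (Fin n))) : ℝ≥0∞ :=
  ⨆ (f : EuclideanSpace ℝ (Fin n) → ℝ) (_ : LipschitzWith 1 f)
    (_ : Integrable f μ) (_ : Integrable f ν),
    ENNReal.ofReal |(∫ y, f y ∂μ) - ∫ y, f y ∂ν|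

/-- The quadratic feature `xᵀ A x`. -/
def quadFeature {d : ℕ} (A : Matrix (Fin d) (Fin d) ℝ) (x : EuclideanSpace ℝ (Fin d)) : ℝ :=
  x.ofLp ⬝ᵥ (A *ᵥ x.ofLp)

/-- The linear feature `uᵀ x`. -/
def linFeature {d : ℕ} (u x : EuclideanSpace ℝ (Fin d)) : ℝ :=
  u.ofLp ⬝ᵥ x.ofLp

/-- Orthonormal quadratic features with balanced matrices: for `x` uniform on the sphere of radius
`√d`, the features `xᵀ Aᵢ x` are centred and orthonormal in `L²`, and the (`ℓ² → ℓ²`) operator norm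
of each `Aᵢ` is at most `κ₁ / √d`. -/
structure OrthogonalQuadraticFeatures {d r : ℕ} (A : Fin r → Matrix (Fin d) (Fin d) ℝ)
    (κ₁ : ℝ) : Prop where
  mean_zero : ∀ i, ∫ x, quadFeature (A i) x ∂(unifSphere d) = 0
  orthonormal : ∀ i j, ∫ x, quadFeature (A i) x * quadFeature (A j) x ∂(unifSphere d) =
    if i = j then 1 else 0
  opNorm_le : ∀ i, ‖Matrix.toEuclideanCLM (𝕜 := ℝ) (A i)‖ ≤ κ₁ / Real.sqrt d

/-- The vector `(xᵀ A₁ x, …, xᵀ A_r x)`. -/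
def quadFeatures {d r : ℕ} (A : Fin r → Matrix (Fin d) (Fin d) ℝ)
    (x : EuclideanSpace ℝ (Fin d)) : EuclideanSpace ℝ (Fin r) :=
  WithLp.toLp 2 (fun i => quadFeature (A i) x)

/-- The vector `(xᵀ A₁ x, …, xᵀ A_r x, u₁ᵀ x, …, u_sᵀ x)`. -/
def quadLinFeatures {d r s : ℕ} (A : Fin r → Matrix (Fin d) (Fin d) ℝ)
    (u : Fin s → EuclideanSpace ℝ (Fin d)) (x : EuclideanSpace ℝ (Fin d)) :
    EuclideanSpace ℝ (Fin (r + s)) :=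
  WithLp.toLp 2 (Fin.append (fun i => quadFeature (A i) x) (fun j => linFeature (u j) x))

end

open scoped RealInnerProductSpace Pointwise

/-! The proof is Stein's method with a Stein kernel, i.e. a matrix `T` of functions with `E[W_i
g(W)] = ∑_j E[T_ij ∂_j g(W)]` for all `C¹` functions `g`. Let `Z` be an independent standard
Gaussian vector and `h` a smooth 1-Lipschitz function. Along the path `cos θ • W + sin θ • Z`, the
Stein identity of `W` followed by Gaussian integration by parts in `Z` moves a derivative onto `g =
∂_i h` and takes it off again. The derivative of `E h` in `θ` becomes a sum of terms `(δ_ij - T_ij)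
∂_i h Z_j`, in which only first derivatives of `h` occur. Integrating over `[0, π/2]` bounds `W₁` by
`π/2 * ∑ E|T_ij - δ_ij|` (`IsSteinKernel.wasserstein1_le`). The sum over all pairs produces the
squared number of features.

The kernel comes from the symmetry of the sphere. Rotation invariance says that derivatives along
rotation fields have mean zero. Summing this over suitable fields gives integration by parts for
linear forms (`integral_inner_mul_unifSphere`), and from it for quadratic forms
(`integral_quadForm_mul_unifSphere`). Hence each feature `w_i` has a vector field `V_i` with `E[w_i
g] = E[∂_{V_i} g]`, and the chain rule makes `T_ij = ∂_{V_i} w_j` a Stein kernel.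

It remains to see that `T_ij` concentrates at `δ_ij`. For symmetric `S`, `R` of trace zero the
kernel entry is `2⟨x, R S x⟩` up to a correction of size `1/d`. Its mean is governed by `2 tr(R S) =
δ (1 + 2/d)`, by orthonormality, and its variance by `‖R S‖_F² ≤ ‖R‖² ‖S‖_F²` with `‖S‖_F² ≤ 1`. The
standard deviation is thus of order `ε = κ₁ / √d`. Normalisation also forces `1/d ≤ 2ε`
(`scale_pos`), which absorbs all corrections. Entries involving linear features are treated alike.
-/

/-- If a measure is invariant under a flow, then the derivative of an observable along the flow has
mean zero. -/
lemma integral_deriv_along_measurePreserving_eq_zero {E : Type*} [MeasurableSpace E]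
    {μ : Measure E} {R : ℝ → E → E} (hR : ∀ t, MeasurePreserving (R t) μ μ) (hR0 : R 0 = id)
    {F : E → ℝ} {F' : ℝ → E → ℝ} {B : E → ℝ}
    (hF : Integrable F μ) (hF' : AEStronglyMeasurable (F' 0) μ)
    (hB : Integrable B μ) (hbound : ∀ᵐ x ∂μ, ∀ t, |F' t x| ≤ B x)
    (hderiv : ∀ x t, HasDerivAt (fun t => F (R t x)) (F' t x) t) :
    ∫ x, F' 0 x ∂μ = 0 := by
  have h := hasDerivAt_integral_of_dominated_loc_of_deriv_le (μ := μ) (F := fun t x => F (R t x))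
    (F' := F') (x₀ := (0 : ℝ)) (bound := B) (s := Set.univ) Filter.univ_mem
    (Filter.Eventually.of_forall fun t => ((hR t).integrable_comp_of_integrable hF).1)
    (by simpa [hR0] using hF) hF'
    (hbound.mono fun x hx t _ => by simpa using hx t) hB
    (Filter.Eventually.of_forall fun x t _ => hderiv x t)
  have hconst : (fun t => ∫ x, F (R t x) ∂μ) = fun _ => ∫ x, F x ∂μ := by
    funext t
    conv_rhs => rw [← (hR t).map_eq]
    rw [integral_map (hR t).measurable.aemeasurable]
    rw [(hR t).map_eq]; exact hF.1
  rw [hconst] at h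
  exact h.2.unique (hasDerivAt_const _ _)

/-! ### Gaussian integration by parts from rotation invariance. -/

section Gaussian

variable {H : Type*} [NormedAddCommGroup H] [InnerProductSpace ℝ H] [FiniteDimensional ℝ H]
  [MeasurableSpace H] [BorelSpace H]

lemma integral_inner_mul_inner_stdGaussian (a b : H) :
    ∫ z, ⟪a, z⟫ * ⟪b, z⟫ ∂stdGaussian H = ⟪a, b⟫ := by
  have h := covarianceBilin_apply (μ := stdGaussian H) IsGaussian.memLp_two_id a b
  rw [covarianceBilin_stdGaussian] at h
  simp only [id, integral_id_stdGaussian, sub_zero] at h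
  exact h.symm

lemma integrable_inner_mul_inner_stdGaussian (a b : H) :
    Integrable (fun z => ⟪a, z⟫ * ⟪b, z⟫) (stdGaussian H) := by
  have h : ∀ a : H, MemLp (fun z : H => ⟪a, z⟫) 2 (stdGaussian H) := fun a =>
    (IsGaussian.memLp_two_id (μ := stdGaussian H)).continuousLinearMap_comp (innerSL ℝ a)
  exact (h a).integrable_mul (h b)

lemma integrable_norm_sq_stdGaussian : Integrable (fun z : H => ‖z‖ ^ 2) (stdGaussian H) :=
  (IsGaussian.memLp_two_id (μ := stdGaussian H)).norm.integrable_sq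

/-- Gaussian integration by parts. -/
lemma integral_mul_inner_stdGaussian {ψ : H → ℝ} (hψ : ContDiff ℝ 1 ψ) {M₀ M₁ : ℝ}
    (h₀ : ∀ z, |ψ z| ≤ M₀) (h₁ : ∀ z, ‖fderiv ℝ ψ z‖ ≤ M₁) (a : H) :
    ∫ z, ψ z * ⟪a, z⟫ ∂stdGaussian H = ∫ z, fderiv ℝ ψ z a ∂stdGaussian H := by
  set γ := stdGaussian H
  have hM₀ : 0 ≤ M₀ := (abs_nonneg _).trans (h₀ 0)
  have hM₁ : 0 ≤ M₁ := (norm_nonneg _).trans (h₁ 0)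
  have hid : Integrable (fun z : H => ‖z‖) γ := IsGaussian.integrable_id.norm
  have hid1 : Integrable (fun p : H × H => ‖p.1‖) (γ.prod γ) := hid.comp_fst γ
  have hid2 : Integrable (fun p : H × H => ‖p.2‖) (γ.prod γ) := hid.comp_snd γ
  have hsq1 : Integrable (fun p : H × H => ‖p.1‖ ^ 2) (γ.prod γ) :=
    integrable_norm_sq_stdGaussian.comp_fst γ
  have hsq2 : Integrable (fun p : H × H => ‖p.2‖ ^ 2) (γ.prod γ) :=
    integrable_norm_sq_stdGaussian.comp_snd γ
  have hdψ : Continuous (fderiv ℝ ψ) := hψ.continuous_fderiv one_ne_zero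
  have hcψ : Continuous ψ := hψ.continuous
  let R : ℝ → H × H → H × H := fun t => ContinuousLinearMap.rotation t
  -- `G` is the derivative at `t = 0` of `(z, z') ↦ ψ z * ⟪a, z'⟫` along the rotation of the pair.
  -- Since `γ ⊗ γ` is invariant under this rotation, `G` has mean zero.
  let G : H × H → ℝ := fun p => fderiv ℝ ψ p.1 p.2 * ⟪a, p.2⟫ - ψ p.1 * ⟪a, p.1⟫
  have hnorm : ∀ (t : ℝ) (p : H × H), ‖(R t p).1‖ ≤ ‖p.1‖ + ‖p.2‖ ∧
      ‖(R t p).2‖ ≤ ‖p.1‖ + ‖p.2‖ := by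
    intro t p
    have key : ∀ c s : ℝ, |c| ≤ 1 → |s| ≤ 1 → ‖c • p.1 + s • p.2‖ ≤ ‖p.1‖ + ‖p.2‖ := by
      intro c s hc hs
      refine (norm_add_le _ _).trans ?_
      rw [norm_smul, norm_smul, Real.norm_eq_abs, Real.norm_eq_abs]
      exact add_le_add (mul_le_of_le_one_left (norm_nonneg _) hc)
        (mul_le_of_le_one_left (norm_nonneg _) hs)
    exact ⟨key _ _ (Real.abs_cos_le_one t) (Real.abs_sin_le_one t),
      key _ _ (by rw [abs_neg]; exact Real.abs_sin_le_one t) (Real.abs_cos_le_one t)⟩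
  have hG : ∀ p, |G p| ≤ M₁ * ‖p.2‖ * (‖a‖ * ‖p.2‖) + M₀ * (‖a‖ * ‖p.1‖) := by
    intro p
    refine (abs_sub _ _).trans ?_
    rw [abs_mul, abs_mul]
    gcongr
    · exact ((fderiv ℝ ψ p.1).le_opNorm _).trans (by gcongr; exact h₁ _)
    · exact abs_real_inner_le_norm _ _
    · exact h₀ _
    · exact abs_real_inner_le_norm _ _
  have hGc : Continuous G := by
    have : Continuous fun p : H × H => fderiv ℝ ψ p.1 p.2 :=
      (hdψ.comp continuous_fst).clm_apply continuous_snd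
    fun_prop
  have hzero : ∫ p, G p ∂(γ.prod γ) = 0 := by
    have := integral_deriv_along_measurePreserving_eq_zero (μ := γ.prod γ) (R := R)
      (F := fun p => ψ p.1 * ⟪a, p.2⟫) (F' := fun t p => G (R t p))
      (B := fun p => M₁ * ‖a‖ * (2 * ‖p.1‖ ^ 2 + 2 * ‖p.2‖ ^ 2) + M₀ * ‖a‖ * (‖p.1‖ + ‖p.2‖))
      (fun t => ⟨(ContinuousLinearMap.rotation t).continuous.measurable,
        IsGaussian.map_rotation_eq_self integral_id_stdGaussian t⟩)
      (by ext p <;> simp [R, ContinuousLinearMap.rotation_apply])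
      ?_ ?_ ?_ ?_ ?_
    · simpa [R, ContinuousLinearMap.rotation_apply] using this
    · refine (hid2.const_mul (M₀ * ‖a‖)).mono' (by fun_prop) (.of_forall fun p => ?_)
      rw [norm_mul, mul_assoc]
      gcongr
      · exact h₀ _
      · exact abs_real_inner_le_norm _ _
    · exact (hGc.comp (ContinuousLinearMap.rotation 0).continuous).aestronglyMeasurable
    · exact (((hsq1.const_mul 2).add (hsq2.const_mul 2)).const_mul _).add
        ((hid1.add hid2).const_mul _)
    · refine .of_forall fun p t => (hG _).trans ?_
      obtain ⟨h1, h2⟩ := hnorm t p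
      have : M₁ * ‖(R t p).2‖ * (‖a‖ * ‖(R t p).2‖) = M₁ * ‖a‖ * ‖(R t p).2‖ ^ 2 := by ring
      rw [this, ← mul_assoc M₀]
      have h3 : ‖(R t p).2‖ ^ 2 ≤ 2 * ‖p.1‖ ^ 2 + 2 * ‖p.2‖ ^ 2 :=
        (pow_le_pow_left₀ (norm_nonneg _) h2 2).trans (by nlinarith [sq_nonneg (‖p.1‖ - ‖p.2‖)])
      gcongr
    · intro p t
      have d1 : HasDerivAt (fun t => (R t p).1) ((R t p).2) t := by
        exact ((Real.hasDerivAt_cos t).smul_const p.1).add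
          ((Real.hasDerivAt_sin t).smul_const p.2)
      have d2 : HasDerivAt (fun t => (R t p).2) (-(R t p).1) t := by
        have := ((Real.hasDerivAt_sin t).neg.smul_const p.1).add
          ((Real.hasDerivAt_cos t).smul_const p.2)
        refine this.congr_deriv ?_
        simp [R, ContinuousLinearMap.rotation_apply, add_comm]
      have d3 := ((hψ.differentiable one_ne_zero _).hasFDerivAt.comp_hasDerivAt t d1)
      have d4 := (innerSL ℝ a).hasFDerivAt.comp_hasDerivAt t d2
      refine (d3.mul d4).congr_deriv ?_
      simp only [G, Function.comp_apply, innerSL_apply_apply, inner_neg_right]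
      ring
  have hI1 : Integrable (fun p : H × H => fderiv ℝ ψ p.1 p.2 * ⟪a, p.2⟫) (γ.prod γ) := by
    have : Continuous fun p : H × H => fderiv ℝ ψ p.1 p.2 :=
      (hdψ.comp continuous_fst).clm_apply continuous_snd
    refine (hsq2.const_mul (M₁ * ‖a‖)).mono' (by fun_prop) (.of_forall fun p => ?_)
    rw [norm_mul, show M₁ * ‖a‖ * ‖p.2‖ ^ 2 = (M₁ * ‖p.2‖) * (‖a‖ * ‖p.2‖) by ring]
    gcongr
    · exact ((fderiv ℝ ψ p.1).le_opNorm _).trans (by gcongr; exact h₁ _)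
    · exact abs_real_inner_le_norm _ _
  have hI2 : Integrable (fun p : H × H => ψ p.1 * ⟪a, p.1⟫) (γ.prod γ) := by
    refine (hid1.const_mul (M₀ * ‖a‖)).mono' (by fun_prop) (.of_forall fun p => ?_)
    rw [norm_mul, mul_assoc]
    gcongr
    · exact h₀ _
    · exact abs_real_inner_le_norm _ _
  rw [integral_sub hI1 hI2, sub_eq_zero, integral_prod _ hI1,
    integral_fun_fst (fun z => ψ z * ⟪a, z⟫)] at hzero
  simp only [probReal_univ, one_smul] at hzero
  rw [← hzero]
  refine integral_congr_ae (.of_forall fun z => ?_)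
  -- By Riesz the integral over `z'` is a Gaussian covariance: the mean of `∂_{z'} ψ(z) * ⟪a, z'⟫`
  -- is `∂_a ψ(z)`.
  have : ∀ y, fderiv ℝ ψ z y = ⟪(InnerProductSpace.toDual ℝ H).symm (fderiv ℝ ψ z), y⟫ := by
    simp
  simp only [this]
  rw [integral_inner_mul_inner_stdGaussian]

end Gaussian

/-! ### Rotation invariance of the sphere and its Stein identity. -/

section Sphere

variable {d : ℕ}

local notation "𝔼" => EuclideanSpace ℝ (Fin d)

lemma measurable_sphere_smul :
    Measurable (fun x : Metric.sphere (0 : 𝔼) 1 => Real.sqrt d • (x : 𝔼)) := by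
  fun_prop

/-- The surface measure of a set is a multiple of the volume of the cone over it, and a linear
isometry carries cones to cones while preserving volume. -/
lemma toSphere_preimage_isometry (U : 𝔼 ≃ₗᵢ[ℝ] 𝔼) {s : Set (Metric.sphere (0 : 𝔼) 1)}
    (hs : MeasurableSet s) :
    (volume : Measure 𝔼).toSphere
      ((fun x : Metric.sphere (0 : 𝔼) 1 => (⟨U x, by simp⟩ : Metric.sphere (0 : 𝔼) 1)) ⁻¹' s) =
      (volume : Measure 𝔼).toSphere s := by
  have hV : Measurable
      (fun x : Metric.sphere (0 : 𝔼) 1 => (⟨U x, by simp⟩ : Metric.sphere (0 : 𝔼) 1)) :=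
    Measurable.subtype_mk (U.continuous.measurable.comp measurable_subtype_coe)
  rw [Measure.toSphere_apply' _ (hV hs), Measure.toSphere_apply' _ hs]
  congr 1
  rw [← (U.measurePreserving).measure_preimage_emb U.toHomeomorph.measurableEmbedding
    (Set.Ioo (0 : ℝ) 1 • (Subtype.val '' s))]
  congr 1
  ext y
  simp only [Set.mem_smul, Set.mem_image, Set.mem_preimage]
  constructor
  · rintro ⟨c, hc, _, ⟨x, hx, rfl⟩, rfl⟩
    exact ⟨c, hc, U x, ⟨_, hx, rfl⟩, by simp⟩
  · rintro ⟨c, hc, _, ⟨x, hx, rfl⟩, h⟩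
    refine ⟨c, hc, U.symm x, ⟨⟨U.symm x, by simp⟩, by simpa using hx, rfl⟩, ?_⟩
    apply U.injective
    simpa using h

lemma map_isometry_unifSphere (U : 𝔼 ≃ₗᵢ[ℝ] 𝔼) : (unifSphere d).map U = unifSphere d := by
  have hU : Measurable U := U.continuous.measurable
  rw [unifSphere, Measure.map_map hU measurable_sphere_smul]
  have hV : Measurable
      (fun x : Metric.sphere (0 : 𝔼) 1 => (⟨U x, by simp⟩ : Metric.sphere (0 : 𝔼) 1)) :=
    Measurable.subtype_mk (hU.comp measurable_subtype_coe)
  have hcomp : U ∘ (fun x : Metric.sphere (0 : 𝔼) 1 => Real.sqrt d • (x : 𝔼)) =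
      (fun x : Metric.sphere (0 : 𝔼) 1 => Real.sqrt d • (x : 𝔼)) ∘
      (fun x : Metric.sphere (0 : 𝔼) 1 => (⟨U x, by simp⟩ : Metric.sphere (0 : 𝔼) 1)) := by
    ext x; simp
  rw [hcomp, ← Measure.map_map measurable_sphere_smul hV, Measure.map_smul]
  congr 2
  ext s hs
  rw [Measure.map_apply hV hs, toSphere_preimage_isometry U hs]

lemma isProbabilityMeasure_unifSphere (hd : 1 ≤ d) : IsProbabilityMeasure (unifSphere d) := by
  have : Nonempty (Fin d) := ⟨⟨0, hd⟩⟩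
  constructor
  rw [unifSphere, Measure.map_apply measurable_sphere_smul .univ, Set.preimage_univ,
    Measure.smul_apply, smul_eq_mul]
  refine ENNReal.inv_mul_cancel ?_ (measure_ne_top _ _)
  exact Measure.measure_univ_ne_zero.2 (Measure.toSphere_ne_zero (volume : Measure 𝔼))

lemma ae_norm_unifSphere : ∀ᵐ x ∂unifSphere d, ‖x‖ = Real.sqrt d := by
  rw [unifSphere, ae_map_iff measurable_sphere_smul.aemeasurable
    (measurableSet_eq_fun measurable_norm measurable_const)]
  refine .of_forall fun x => ?_
  simp [norm_smul]

lemma ae_norm_sq_unifSphere : ∀ᵐ x ∂unifSphere d, ‖x‖ ^ 2 = d := by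
  filter_upwards [ae_norm_unifSphere (d := d)] with x hx
  rw [hx, Real.sq_sqrt (Nat.cast_nonneg d)]

lemma exists_ae_abs_le_of_continuous {F : 𝔼 → ℝ} (hF : Continuous F) :
    ∃ C, ∀ᵐ x ∂unifSphere d, |F x| ≤ C := by
  obtain ⟨C, hC⟩ := (isCompact_closedBall (0 : 𝔼) (Real.sqrt d)).exists_bound_of_continuousOn
    hF.continuousOn
  refine ⟨C, ?_⟩
  filter_upwards [ae_norm_unifSphere (d := d)] with x hx
  exact hC x (by simp [hx])

lemma integrable_unifSphere_of_continuous (hd : 1 ≤ d) {F : 𝔼 → ℝ} (hF : Continuous F) :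
    Integrable F (unifSphere d) := by
  have := isProbabilityMeasure_unifSphere hd
  obtain ⟨C, hC⟩ := exists_ae_abs_le_of_continuous hF
  exact (integrable_const C).mono' hF.aestronglyMeasurable hC

/-- The derivative of a `C¹` function along a rotation field has mean zero on the sphere. -/
lemma integral_fderiv_skew_unifSphere (hd : 1 ≤ d) {F : 𝔼 → ℝ} (hF : ContDiff ℝ 1 F)
    {K : 𝔼 →L[ℝ] 𝔼} (hK : K ∈ skewAdjoint (𝔼 →L[ℝ] 𝔼)) :
    ∫ x, fderiv ℝ F x (K x) ∂unifSphere d = 0 := by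
  have := isProbabilityMeasure_unifSphere hd
  -- The flow of the linear field `K` is `exp (t K)`, which is orthogonal because `K` is skew.
  have hmem : ∀ t : ℝ, NormedSpace.exp (t • K) ∈ unitary (𝔼 →L[ℝ] 𝔼) := fun t =>
    let : NormedAlgebra ℚ (𝔼 →L[ℝ] 𝔼) := NormedAlgebra.restrictScalars ℚ ℝ _
    NormedSpace.exp_mem_unitary_of_mem_skewAdjoint (skewAdjoint.smul_mem t hK)
  let U : ℝ → (𝔼 ≃ₗᵢ[ℝ] 𝔼) := fun t => Unitary.linearIsometryEquiv ⟨_, hmem t⟩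
  have hU : ∀ t x, U t x = NormedSpace.exp (t • K) x := fun t x => rfl
  have hU0 : ∀ x, U 0 x = x := fun x => by
    rw [hU, zero_smul ℝ K, NormedSpace.exp_zero]; rfl
  have hdF : Continuous (fderiv ℝ F) := hF.continuous_fderiv one_ne_zero
  obtain ⟨C, hC⟩ := (isCompact_closedBall (0 : 𝔼) (Real.sqrt d)).exists_bound_of_continuousOn
    hdF.continuousOn
  have h := integral_deriv_along_measurePreserving_eq_zero (μ := unifSphere d)
    (R := fun t => U t) (F := F) (F' := fun t x => fderiv ℝ F (U t x) (K (U t x)))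
    (B := fun _ => C * (‖K‖ * Real.sqrt d))
    (fun t => ⟨(U t).continuous.measurable, map_isometry_unifSphere (U t)⟩)
    (by ext1 x; exact hU0 x) (integrable_unifSphere_of_continuous hd hF.continuous)
    ?_ (integrable_const _) ?_ ?_
  · simpa only [hU0] using h
  · have : Continuous fun x => fderiv ℝ F (U 0 x) (K (U 0 x)) :=
      (hdF.comp (U 0).continuous).clm_apply (K.continuous.comp (U 0).continuous)
    exact this.aestronglyMeasurable
  · filter_upwards [ae_norm_unifSphere (d := d)] with x hx t
    have hn : ‖U t x‖ = Real.sqrt d := by simp [hx]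
    refine ((fderiv ℝ F (U t x)).le_opNorm _).trans ?_
    have h1 := hC (U t x) (by simp [hx])
    have h2 := K.le_opNorm (U t x)
    rw [hn] at h2
    exact mul_le_mul h1 h2 (norm_nonneg _) ((norm_nonneg _).trans h1)
  · intro x t
    have h1 : HasDerivAt (fun t => U t x) (K (U t x)) t :=
      (hasDerivAt_exp_smul_const' K t).clm_apply (hasDerivAt_const t x) |>.congr_deriv
        (by simp [hU])
    exact (hF.differentiable one_ne_zero _).hasFDerivAt.comp_hasDerivAt t h1

/-- The Stein identity of the sphere for linear functions. -/
lemma integral_inner_mul_unifSphere (hd : 1 ≤ d) {G : 𝔼 → ℝ} (hG : ContDiff ℝ 1 G) (a : 𝔼) :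
    ((d : ℝ) - 1) * ∫ x, ⟪a, x⟫ * G x ∂unifSphere d =
      ∫ x, (d * fderiv ℝ G x a - ⟪a, x⟫ * fderiv ℝ G x x) ∂unifSphere d := by
  have hdG : Continuous (fderiv ℝ G) := hG.continuous_fderiv one_ne_zero
  let b := EuclideanSpace.basisFun (Fin d) ℝ
  -- `K k` generates rotation in the plane of `a` and `b k`. Testing it on `⟪b k, ·⟫ * G` and
  -- summing over `k` recovers `‖x‖² ∂_a G - ⟪a, x⟫ ∂_x G`, at the cost of `(d - 1) ⟪a, x⟫ G`.
  let K : Fin d → 𝔼 →L[ℝ] 𝔼 := fun k =>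
    (innerSL ℝ (b k)).smulRight a - (innerSL ℝ a).smulRight (b k)
  have hK : ∀ k, K k ∈ skewAdjoint (𝔼 →L[ℝ] 𝔼) := by
    intro k
    rw [skewAdjoint.mem_iff, ContinuousLinearMap.star_eq_adjoint]
    symm
    rw [ContinuousLinearMap.eq_adjoint_iff]
    intro x y
    simp only [K, neg_apply, sub_apply,
      ContinuousLinearMap.smulRight_apply, innerSL_apply_apply, inner_neg_left, inner_sub_left,
      inner_sub_right, real_inner_smul_left, real_inner_smul_right,
      real_inner_comm x a, real_inner_comm x (b k)]
    ring
  have hzero : ∀ k, ∫ x, fderiv ℝ (fun y => ⟪b k, y⟫ * G y) x (K k x) ∂unifSphere d = 0 :=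
    fun k => integral_fderiv_skew_unifSphere hd
      ((innerSL ℝ (b k)).contDiff.mul hG) (hK k)
  have hfd : ∀ k x v, fderiv ℝ (fun y => ⟪b k, y⟫ * G y) x v =
      ⟪b k, x⟫ * fderiv ℝ G x v + G x * ⟪b k, v⟫ := by
    intro k x v
    have := (innerSL ℝ (b k)).hasFDerivAt (x := x) |>.mul
      (hG.differentiable one_ne_zero x).hasFDerivAt
    have h2 := this.fderiv
    simp only [innerSL_apply_apply] at h2
    erw [h2]
    simp
  have hsum : ∀ x, ∑ k, fderiv ℝ (fun y => ⟪b k, y⟫ * G y) x (K k x) =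
      ‖x‖ ^ 2 * fderiv ℝ G x a - ⟪a, x⟫ * fderiv ℝ G x x - ((d : ℝ) - 1) * (⟪a, x⟫ * G x) := by
    intro x
    have e1 : ∑ k, ⟪b k, x⟫ * ⟪b k, x⟫ = ‖x‖ ^ 2 := by
      rw [← b.sum_sq_inner_right x]
      exact Finset.sum_congr rfl fun k _ => by ring
    have e2 : ∑ k, ⟪b k, x⟫ * ⟪b k, a⟫ = ⟪a, x⟫ := by
      rw [← b.sum_inner_mul_inner a x]
      exact Finset.sum_congr rfl fun k _ => by rw [real_inner_comm a]; ring
    have e3 : ∑ k, ⟪b k, x⟫ * fderiv ℝ G x (b k) = fderiv ℝ G x x := by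
      have := congrArg (fderiv ℝ G x) (b.sum_repr' x)
      rw [map_sum] at this
      simpa only [map_smul, smul_eq_mul] using this
    have e4 : ∀ k, ⟪b k, b k⟫ = 1 := fun k => by simp
    calc ∑ k, fderiv ℝ (fun y => ⟪b k, y⟫ * G y) x (K k x)
        = ∑ k, (⟪b k, x⟫ * ⟪b k, x⟫ * fderiv ℝ G x a
            - ⟪a, x⟫ * (⟪b k, x⟫ * fderiv ℝ G x (b k))
            + (G x * (⟪b k, x⟫ * ⟪b k, a⟫) - G x * ⟪a, x⟫)) := by
          refine Finset.sum_congr rfl fun k _ => ?_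
          rw [hfd]
          simp only [K, sub_apply, ContinuousLinearMap.smulRight_apply,
            innerSL_apply_apply, map_sub, map_smul, smul_eq_mul, inner_sub_right,
            real_inner_smul_right, e4]
          ring
      _ = _ := by
          rw [Finset.sum_add_distrib, Finset.sum_sub_distrib, Finset.sum_sub_distrib,
            ← Finset.sum_mul, ← Finset.mul_sum, ← Finset.mul_sum, e1, e2, e3]
          simp
          ring
  have hci : ∀ k, Integrable (fun x => fderiv ℝ (fun y => ⟪b k, y⟫ * G y) x (K k x))
      (unifSphere d) := fun k => by
    refine integrable_unifSphere_of_continuous hd ?_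
    exact (((innerSL ℝ (b k)).contDiff.mul hG).continuous_fderiv one_ne_zero).clm_apply
      (K k).continuous
  have htot : ∫ x, ∑ k, fderiv ℝ (fun y => ⟪b k, y⟫ * G y) x (K k x) ∂unifSphere d = 0 := by
    rw [integral_finsetSum _ fun k _ => hci k]
    exact Finset.sum_eq_zero fun k _ => hzero k
  have hcG := hG.continuous
  have c1 : Continuous fun x => fderiv ℝ G x a := hdG.clm_apply continuous_const
  have c2 : Continuous fun x => fderiv ℝ G x x := hdG.clm_apply continuous_id
  have hrew : ∫ x, ∑ k, fderiv ℝ (fun y => ⟪b k, y⟫ * G y) x (K k x) ∂unifSphere d =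
      ∫ x, ((d * fderiv ℝ G x a - ⟪a, x⟫ * fderiv ℝ G x x)
        - ((d : ℝ) - 1) * (⟪a, x⟫ * G x)) ∂unifSphere d := by
    refine integral_congr_ae ?_
    filter_upwards [ae_norm_sq_unifSphere (d := d)] with x hx
    rw [hsum, hx]
  rw [hrew, integral_sub (integrable_unifSphere_of_continuous hd (by fun_prop))
    (integrable_unifSphere_of_continuous hd (by fun_prop)), integral_const_mul, sub_eq_zero] at htot
  exact htot.symm

end Sphere

/-! ### Mollification of Lipschitz functions. -/

section Smoothing

open scoped Convolution ContDiff

/-- Convolving a Lipschitz function with an integrable kernel gives a Lipschitz function. -/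
lemma norm_integral_smul_sub_le_of_lipschitz {H : Type*} [NormedAddCommGroup H]
    [MeasurableSpace H] [BorelSpace H] {F : Type*} [NormedAddCommGroup F] [NormedSpace ℝ F]
    {μ : Measure H} [IsFiniteMeasureOnCompacts μ] {k : H → F} (hk : Continuous k)
    (hkc : HasCompactSupport k) {f : H → ℝ}
    (hf : LipschitzWith 1 f) (x y : H) :
    ‖(∫ t, f (x - t) • k t ∂μ) - ∫ t, f (y - t) • k t ∂μ‖ ≤ (∫ t, ‖k t‖ ∂μ) * ‖x - y‖ := by
  have hint : ∀ x, Integrable (fun t => f (x - t) • k t) μ := fun x => by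
    have hc : Continuous fun t => f (x - t) := hf.continuous.comp (by fun_prop)
    exact (hc.smul hk).integrable_of_hasCompactSupport hkc.smul_left
  have hkn : Integrable (fun t => ‖k t‖) μ :=
    (hk.integrable_of_hasCompactSupport hkc).norm
  rw [← integral_sub (hint x) (hint y), ← integral_mul_const]
  refine norm_integral_le_of_norm_le (hkn.mul_const _) (.of_forall fun t => ?_)
  rw [← sub_smul, norm_smul, mul_comm]
  gcongr
  simpa [dist_eq_norm] using hf.dist_le_mul (x - t) (y - t)

/-- A `1`-Lipschitz function is uniformly close to smooth `1`-Lipschitz functions with bounded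
second derivative. -/
lemma LipschitzWith.exists_smooth_approx {H : Type*} [NormedAddCommGroup H] [NormedSpace ℝ H]
    [FiniteDimensional ℝ H] {f : H → ℝ} (hf : LipschitzWith 1 f) {ε : ℝ}
    (hε : 0 < ε) :
    ∃ (h : H → ℝ) (M : ℝ), ContDiff ℝ 2 h ∧ (∀ x, |h x - f x| ≤ ε) ∧
      (∀ x, ‖fderiv ℝ h x‖ ≤ 1) ∧ ∀ x, ‖fderiv ℝ (fderiv ℝ h) x‖ ≤ M := by
  borelize H
  let μ : Measure H := Measure.addHaar
  -- The outer radius `ε` suffices: averaging a 1-Lipschitz function over a ball of radius `ε` moves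
  -- its values by at most `ε`.
  let φ : ContDiffBump (0 : H) := ⟨ε / 2, ε, by positivity, by linarith⟩
  let k : H → ℝ := φ.normed μ
  have hkc : HasCompactSupport k := φ.hasCompactSupport_normed
  have hks : ContDiff ℝ ∞ k := φ.contDiff_normed
  have hfl : LocallyIntegrable f μ := hf.continuous.locallyIntegrable
  let h : H → ℝ := k ⋆[ContinuousLinearMap.lsmul ℝ ℝ, μ] f
  have hh : ∀ x, h x = ∫ t, f (x - t) • k t ∂μ := fun x => by
    simp only [h, convolution_def, ContinuousLinearMap.lsmul_apply, smul_eq_mul, mul_comm]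
  -- With the derivative placed on the kernel, `fderiv ℝ h` is again a convolution of `f`, hence
  -- Lipschitz with the `L¹` norm of `fderiv ℝ k` as constant. This bounds the second derivative.
  have hfd : ∀ x, fderiv ℝ h x = ∫ t, f (x - t) • fderiv ℝ k t ∂μ := fun x => by
    rw [(hkc.hasFDerivAt_convolution_left (ContinuousLinearMap.lsmul ℝ ℝ) (hks.of_le (by simp))
      hfl x).fderiv, convolution_def]
    refine integral_congr_ae (.of_forall fun t => ?_)
    ext v
    simp [ContinuousLinearMap.precompL_apply, mul_comm]
  have hk1 : ∫ t, ‖k t‖ ∂μ = 1 := by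
    rw [← φ.integral_normed (μ := μ)]
    refine integral_congr_ae (.of_forall fun t => ?_)
    exact abs_of_nonneg (φ.nonneg_normed t)
  have hdkc : Continuous (fderiv ℝ k) := hks.continuous_fderiv (by simp)
  refine ⟨h, ∫ t, ‖fderiv ℝ k t‖ ∂μ, ?_, ?_, ?_, ?_⟩
  · exact (hkc.contDiff_convolution_left _ (n := 2) (hks.of_le (mod_cast le_top)) hfl)
  · intro x
    refine φ.dist_normed_convolution_le (x₀ := x) hfl.aestronglyMeasurable fun y hy => ?_
    refine (hf.dist_le_mul y x).trans ?_
    simpa using (Metric.mem_ball.1 hy).le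
  · intro x
    have hl : LipschitzWith 1 h := LipschitzWith.of_dist_le_mul fun x y => by
      rw [dist_eq_norm, dist_eq_norm, hh, hh]
      have := norm_integral_smul_sub_le_of_lipschitz (μ := μ) hks.continuous hkc hf x y
      rwa [hk1] at this
    simpa using norm_fderiv_le_of_lipschitz ℝ hl
  · intro x
    have hnn : 0 ≤ ∫ t, ‖fderiv ℝ k t‖ ∂μ := integral_nonneg fun _ => norm_nonneg _
    have hl : LipschitzWith ⟨_, hnn⟩ (fderiv ℝ h) := LipschitzWith.of_dist_le_mul fun x y => by
      rw [dist_eq_norm, dist_eq_norm, hfd, hfd]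
      exact norm_integral_smul_sub_le_of_lipschitz hdkc (hkc.fderiv ℝ) hf x y
    exact norm_fderiv_le_of_lipschitz ℝ hl

end Smoothing

/-! ### Stein kernels and the smart path to the Gaussian. -/

section Stein

variable {n : ℕ}

local notation "ℍ" => EuclideanSpace ℝ (Fin n)

lemma integral_abs_coord_stdGaussian_le (j : Fin n) :
    ∫ z : ℍ, |z j| ∂stdGaussian ℍ ≤ 1 := by
  have hz : ∀ z : ℍ, ⟪EuclideanSpace.single j (1 : ℝ), z⟫ = z j := fun z => by
    simp only [EuclideanSpace.inner_single_left, map_one, one_mul]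
  have h1 : ∫ z : ℍ, z j * z j ∂stdGaussian ℍ = 1 := by
    have := integral_inner_mul_inner_stdGaussian (H := ℍ) (EuclideanSpace.single j 1)
      (EuclideanSpace.single j 1)
    simp only [hz] at this
    rw [this]; simp
  have h2 : Integrable (fun z : ℍ => z j * z j) (stdGaussian ℍ) := by
    have := integrable_inner_mul_inner_stdGaussian (H := ℍ) (EuclideanSpace.single j 1)
      (EuclideanSpace.single j 1)
    simpa only [hz] using this
  calc ∫ z : ℍ, |z j| ∂stdGaussian ℍ
      ≤ ∫ z : ℍ, (1 / 2 + 1 / 2 * (z j * z j)) ∂stdGaussian ℍ := by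
        refine integral_mono_of_nonneg (.of_forall fun z => abs_nonneg _)
          ((integrable_const _).add (h2.const_mul _)) (.of_forall fun z => ?_)
        have := sq_nonneg (|z j| - 1)
        have h3 := abs_mul_abs_self (z j)
        show |z j| ≤ _
        nlinarith
    _ = 1 := by
        rw [integral_add (integrable_const _) (h2.const_mul _), integral_const_mul, h1]
        norm_num

variable {Ω : Type*} [MeasurableSpace Ω] {μ : Measure Ω} [IsProbabilityMeasure μ]

/-- The smart path between a random vector `W` and an independent Gaussian vector: the
derivative of the interpolation. -/
lemma hasDerivAt_integral_interpolation {W : Ω → ℍ} (hWm : Measurable W) (hW : Integrable W μ)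
    {h : ℍ → ℝ} (hh : ContDiff ℝ 1 h) (h₁ : ∀ x, ‖fderiv ℝ h x‖ ≤ 1) (θ : ℝ) :
    HasDerivAt (fun θ => ∫ p, h (Real.cos θ • W p.1 + Real.sin θ • p.2) ∂μ.prod (stdGaussian ℍ))
      (∫ p, fderiv ℝ h (Real.cos θ • W p.1 + Real.sin θ • p.2)
        (-Real.sin θ • W p.1 + Real.cos θ • p.2) ∂μ.prod (stdGaussian ℍ)) θ := by
  have hdh : Continuous (fderiv ℝ h) := hh.continuous_fderiv one_ne_zero
  have hL : LipschitzWith 1 h := lipschitzWith_of_nnnorm_fderiv_le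
    (hh.differentiable one_ne_zero) fun x => h₁ x
  have hB : Integrable (fun p : Ω × ℍ => ‖W p.1‖ + ‖p.2‖) (μ.prod (stdGaussian ℍ)) :=
    (hW.norm.comp_fst _).add
      ((IsGaussian.integrable_id (μ := stdGaussian ℍ)).norm.comp_snd μ)
  have hWm' : Measurable fun p : Ω × ℍ => W p.1 := hWm.comp measurable_fst
  have key : ∀ (p : Ω × ℍ) (c s : ℝ), |c| ≤ 1 → |s| ≤ 1 →
      ‖c • W p.1 + s • p.2‖ ≤ ‖W p.1‖ + ‖p.2‖ := by
    intro p c s hc hs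
    refine (norm_add_le _ _).trans ?_
    rw [norm_smul, norm_smul, Real.norm_eq_abs, Real.norm_eq_abs]
    exact add_le_add (mul_le_of_le_one_left (norm_nonneg _) hc)
      (mul_le_of_le_one_left (norm_nonneg _) hs)
  have hmeas : ∀ θ : ℝ, AEStronglyMeasurable
      (fun p : Ω × ℍ => h (Real.cos θ • W p.1 + Real.sin θ • p.2)) (μ.prod (stdGaussian ℍ)) :=
    fun θ => (hh.continuous.measurable.comp (by fun_prop)).aestronglyMeasurable
  refine (hasDerivAt_integral_of_dominated_loc_of_deriv_le
    (bound := fun p : Ω × ℍ => ‖W p.1‖ + ‖p.2‖) (s := Set.univ)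
    (F' := fun θ (p : Ω × ℍ) => fderiv ℝ h (Real.cos θ • W p.1 + Real.sin θ • p.2)
        (-Real.sin θ • W p.1 + Real.cos θ • p.2)) Filter.univ_mem
    (.of_forall hmeas) ?_ ?_ ?_ hB ?_).2
  · refine ((integrable_const |h 0|).add hB).mono' (hmeas θ) (.of_forall fun p => ?_)
    have h2 := hL.dist_le_mul (Real.cos θ • W p.1 + Real.sin θ • p.2) 0
    simp only [dist_eq_norm, sub_zero, NNReal.coe_one, one_mul] at h2
    have h3 := key p _ _ (Real.abs_cos_le_one θ) (Real.abs_sin_le_one θ)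
    have h4 := norm_sub_norm_le (h (Real.cos θ • W p.1 + Real.sin θ • p.2)) (h 0)
    simp only [Real.norm_eq_abs, Pi.add_apply] at h2 h4 ⊢
    linarith
  · refine Measurable.aestronglyMeasurable ?_
    have : Continuous fun q : ℍ × ℍ => fderiv ℝ h q.1 q.2 :=
      (hdh.comp continuous_fst).clm_apply continuous_snd
    have hm : Measurable fun p : Ω × ℍ => (Real.cos θ • W p.1 + Real.sin θ • p.2,
        -Real.sin θ • W p.1 + Real.cos θ • p.2) := by fun_prop
    exact this.measurable.comp hm
  · refine .of_forall fun p θ _ => ?_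
    refine ((fderiv ℝ h _).le_opNorm _).trans ?_
    refine (mul_le_of_le_one_left (norm_nonneg _) (h₁ _)).trans ?_
    exact key p _ _ (by rw [abs_neg]; exact Real.abs_sin_le_one θ) (Real.abs_cos_le_one θ)
  · refine .of_forall fun p θ _ => ?_
    have d1 : HasDerivAt (fun θ => Real.cos θ • W p.1 + Real.sin θ • p.2)
        (-Real.sin θ • W p.1 + Real.cos θ • p.2) θ :=
      ((Real.hasDerivAt_cos θ).smul_const _).add ((Real.hasDerivAt_sin θ).smul_const _)
    exact (hh.differentiable one_ne_zero _).hasFDerivAt.comp_hasDerivAt θ d1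

/-- `T` is a Stein kernel of the random vector `W`. -/
structure IsSteinKernel (μ : Measure Ω) (W : Ω → ℍ) (T : Fin n → Fin n → Ω → ℝ) : Prop where
  integrable : ∀ i j, Integrable (T i j) μ
  integral_mul_eq : ∀ (g : ℍ → ℝ), ContDiff ℝ 1 g → ∀ i,
    ∫ ω, W ω i * g (W ω) ∂μ =
      ∫ ω, ∑ j, T i j ω * fderiv ℝ g (W ω) (EuclideanSpace.single j 1) ∂μ

lemma fderiv_comp_smul_add {g : ℍ → ℝ} (hg : ContDiff ℝ 1 g) (c : ℝ) (v x e : ℍ) :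
    fderiv ℝ (fun w => g (c • w + v)) x e = c * fderiv ℝ g (c • x + v) e := by
  have h1 : HasFDerivAt (fun w : ℍ => c • w + v) (c • ContinuousLinearMap.id ℝ ℍ) x :=
    ((hasFDerivAt_id x).const_smul c).add_const v
  have h2 := (hg.differentiable one_ne_zero (c • x + v)).hasFDerivAt.comp x h1
  have h3 := h2.fderiv
  simp only [Function.comp_def] at h3
  rw [h3]
  simp

/-- Along the smart path, the Stein identities of `W` and of the Gaussian combine. -/
lemma IsSteinKernel.integral_interpolation {W : Ω → ℍ} {T : Fin n → Fin n → Ω → ℝ}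
    (hT : IsSteinKernel μ W T) (hWm : Measurable W) (hW : Integrable W μ)
    {g : ℍ → ℝ} (hg : ContDiff ℝ 1 g) {M : ℝ} (h₀ : ∀ x, |g x| ≤ 1)
    (h₁ : ∀ x, ‖fderiv ℝ g x‖ ≤ M) (i : Fin n) (c s : ℝ) :
    s * ∫ p, W p.1 i * g (c • W p.1 + s • p.2) ∂μ.prod (stdGaussian ℍ) =
      c * ∑ j, ∫ p, T i j p.1 * (g (c • W p.1 + s • p.2) * p.2 j) ∂μ.prod (stdGaussian ℍ) := by
  set γ := stdGaussian ℍ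
  have hdg : Continuous (fderiv ℝ g) := hg.continuous_fderiv one_ne_zero
  have hWm' : Measurable fun p : Ω × ℍ => W p.1 := hWm.comp measurable_fst
  have hgm : AEStronglyMeasurable (fun p : Ω × ℍ => g (c • W p.1 + s • p.2)) (μ.prod γ) :=
    (hg.continuous.measurable.comp (by fun_prop)).aestronglyMeasurable
  have hid : ∀ j, Integrable (fun z : ℍ => z j) γ := fun j =>
    (IsGaussian.integrable_id (μ := γ)).eval_piLp j
  have hI1 : Integrable (fun p : Ω × ℍ => W p.1 i * g (c • W p.1 + s • p.2)) (μ.prod γ) := by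
    have : Integrable (fun p : Ω × ℍ => W p.1 i) (μ.prod γ) := (hW.eval_piLp i).comp_fst γ
    exact this.mul_bdd (c := 1) hgm (.of_forall fun p => h₀ _)
  have hI2 : ∀ j, Integrable (fun p : Ω × ℍ => T i j p.1 *
      fderiv ℝ g (c • W p.1 + s • p.2) (EuclideanSpace.single j 1)) (μ.prod γ) := fun j => by
    refine ((hT.integrable i j).comp_fst γ).mul_bdd (c := M) ?_ (.of_forall fun p => ?_)
    · have : Continuous fun x : ℍ => fderiv ℝ g x (EuclideanSpace.single j 1) :=
        hdg.clm_apply continuous_const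
      exact (this.measurable.comp (by fun_prop)).aestronglyMeasurable
    · refine ((fderiv ℝ g _).le_opNorm _).trans ?_
      simpa using h₁ _
  have hI3 : ∀ j, Integrable (fun p : Ω × ℍ => T i j p.1 *
      (g (c • W p.1 + s • p.2) * p.2 j)) (μ.prod γ) := fun j => by
    have := ((hT.integrable i j).mul_prod (hid j)).mul_bdd (c := 1) hgm (.of_forall fun p => h₀ _)
    refine this.congr (.of_forall fun p => ?_)
    simp only
    ring
  -- Stein identity of `W` with the Gaussian variable frozen; the chain rule contributes the factor
  -- `c`.
  have hA : ∫ p, W p.1 i * g (c • W p.1 + s • p.2) ∂μ.prod γ =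
      c * ∑ j, ∫ p, T i j p.1 *
        fderiv ℝ g (c • W p.1 + s • p.2) (EuclideanSpace.single j 1) ∂μ.prod γ := by
    rw [← integral_finsetSum _ fun j _ => hI2 j, ← integral_const_mul, integral_prod_symm _ hI1,
      integral_prod_symm _ ((integrable_finsetSum _ fun j _ => hI2 j).const_mul c)]
    refine integral_congr_ae (.of_forall fun z => ?_)
    have hgz : ContDiff ℝ 1 fun w : ℍ => g (c • w + s • z) := hg.comp (by fun_prop)
    refine (hT.integral_mul_eq _ hgz i).trans ?_
    refine integral_congr_ae (.of_forall fun ω => ?_)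
    simp only [fderiv_comp_smul_add hg, Finset.mul_sum]
    exact Finset.sum_congr rfl fun j _ => by ring
  -- Gaussian integration by parts with `ω` frozen. Keeping `s` as a factor on the left avoids
  -- dividing by `sin θ`.
  have hB : ∀ j, s * ∫ p, T i j p.1 *
        fderiv ℝ g (c • W p.1 + s • p.2) (EuclideanSpace.single j 1) ∂μ.prod γ =
      ∫ p, T i j p.1 * (g (c • W p.1 + s • p.2) * p.2 j) ∂μ.prod γ := fun j => by
    rw [← integral_const_mul, integral_prod _ (hI3 j), integral_prod _ ((hI2 j).const_mul s)]
    refine integral_congr_ae (.of_forall fun ω => ?_)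
    have hgz : ContDiff ℝ 1 fun z : ℍ => g (s • z + c • W ω) := hg.comp (by fun_prop)
    have hfd : ∀ z, fderiv ℝ (fun z : ℍ => g (s • z + c • W ω)) z =
        s • fderiv ℝ g (s • z + c • W ω) := fun z => by
      ext e; simp [fderiv_comp_smul_add hg]
    have := integral_mul_inner_stdGaussian hgz (M₀ := 1) (M₁ := |s| * M) (fun z => h₀ _)
      (fun z => by
        rw [hfd, norm_smul, Real.norm_eq_abs]
        exact mul_le_mul_of_nonneg_left (h₁ _) (abs_nonneg s)) (EuclideanSpace.single j 1)
    simp only [fderiv_comp_smul_add hg, EuclideanSpace.inner_single_left, map_one, one_mul] at this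
    change ∫ z : ℍ, _ ∂γ = ∫ z : ℍ, _ ∂γ at this
    simp only [add_comm (c • W ω)]
    rw [integral_const_mul, integral_const_mul, integral_const_mul, this, integral_const_mul]
    ring
  rw [hA, mul_left_comm, Finset.mul_sum]
  simp only [hB]

/-- The path derivative is bounded uniformly in `θ`, using `|cos θ| ≤ 1`, `|∂_i h| ≤ 1` and `E|Z_j|
≤ 1`; the mean value inequality on an interval of length `π/2` then concludes. The bound `M` on the
second derivative serves integrability only and is absent from the estimate, so the result survives
the removal of the mollification. -/
lemma IsSteinKernel.abs_integral_sub_le {W : Ω → ℍ} {T : Fin n → Fin n → Ω → ℝ}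
    (hT : IsSteinKernel μ W T) (hWm : Measurable W) (hW : Integrable W μ)
    {h : ℍ → ℝ} (hh : ContDiff ℝ 2 h) {M : ℝ} (h₁ : ∀ x, ‖fderiv ℝ h x‖ ≤ 1)
    (h₂ : ∀ x, ‖fderiv ℝ (fderiv ℝ h) x‖ ≤ M) :
    |(∫ ω, h (W ω) ∂μ) - ∫ z, h z ∂stdGaussian ℍ| ≤
      Real.pi / 2 * ∑ i, ∑ j, ∫ ω, |T i j ω - if i = j then 1 else 0| ∂μ := by
  set γ := stdGaussian ℍ
  set B := ∑ i, ∑ j, ∫ ω, |T i j ω - if i = j then 1 else 0| ∂μ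
  have hdh : ContDiff ℝ 1 (fderiv ℝ h) := hh.fderiv_right (by norm_num)
  let e : Fin n → ℍ := fun i => EuclideanSpace.single i 1
  let g : Fin n → ℍ → ℝ := fun i x => fderiv ℝ h x (e i)
  have hg : ∀ i, ContDiff ℝ 1 (g i) := fun i => hdh.clm_apply contDiff_const
  have hg0 : ∀ i x, |g i x| ≤ 1 := fun i x => by
    refine ((fderiv ℝ h x).le_opNorm _).trans ?_
    simpa [e] using h₁ x
  have hg1 : ∀ i x, ‖fderiv ℝ (g i) x‖ ≤ M := fun i x => by
    have hfd : fderiv ℝ (g i) x = (fderiv ℝ (fderiv ℝ h) x).flip (e i) := by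
      ext v
      have := ((hdh.differentiable one_ne_zero x).hasFDerivAt.clm_apply
        (hasFDerivAt_const (e i) x)).fderiv
      simp only [g]
      rw [this]
      simp
    rw [hfd]
    refine ((fderiv ℝ (fderiv ℝ h) x).flip.le_opNorm _).trans ?_
    rw [ContinuousLinearMap.opNorm_flip]
    simpa [e] using h₂ x
  have hWm' : Measurable fun p : Ω × ℍ => W p.1 := hWm.comp measurable_fst
  let Φ : ℝ → ℝ := fun θ => ∫ p, h (Real.cos θ • W p.1 + Real.sin θ • p.2) ∂μ.prod γ
  let Φ' : ℝ → ℝ := fun θ => ∫ p, fderiv ℝ h (Real.cos θ • W p.1 + Real.sin θ • p.2)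
        (-Real.sin θ • W p.1 + Real.cos θ • p.2) ∂μ.prod γ
  have hΦ : ∀ θ, HasDerivAt Φ (Φ' θ) θ := fun θ =>
    hasDerivAt_integral_interpolation hWm hW (hh.of_le (by norm_num)) h₁ θ
  have hid : ∀ j, Integrable (fun z : ℍ => z j) γ := fun j =>
    (IsGaussian.integrable_id (μ := γ)).eval_piLp j
  have hΦ' : ∀ θ, |Φ' θ| ≤ B := by
    intro θ
    set c := Real.cos θ
    set s := Real.sin θ
    let y : Ω × ℍ → ℍ := fun p => c • W p.1 + s • p.2
    have hgm : ∀ i, AEStronglyMeasurable (fun p : Ω × ℍ => g i (y p)) (μ.prod γ) := fun i =>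
      ((hg i).continuous.measurable.comp (by fun_prop)).aestronglyMeasurable
    have hI1 : ∀ i, Integrable (fun p : Ω × ℍ => W p.1 i * g i (y p)) (μ.prod γ) := fun i => by
      have : Integrable (fun p : Ω × ℍ => W p.1 i) (μ.prod γ) := (hW.eval_piLp i).comp_fst γ
      exact this.mul_bdd (c := 1) (hgm i) (.of_forall fun p => hg0 i _)
    have hI2 : ∀ i j, Integrable (fun p : Ω × ℍ => g i (y p) * p.2 j) (μ.prod γ) := fun i j => by
      have : Integrable (fun p : Ω × ℍ => p.2 j) (μ.prod γ) := (hid j).comp_snd μ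
      exact this.bdd_mul (c := 1) (hgm i) (.of_forall fun p => hg0 i _)
    have hI3 : ∀ i j, Integrable (fun p : Ω × ℍ => T i j p.1 * (g i (y p) * p.2 j))
        (μ.prod γ) := fun i j => by
      have := ((hT.integrable i j).mul_prod (hid j)).mul_bdd (c := 1) (hgm i)
        (.of_forall fun p => hg0 i _)
      refine this.congr (.of_forall fun p => ?_)
      simp only
      ring
    have e1 : Φ' θ = ∑ i, (-s * (∫ p, W p.1 i * g i (y p) ∂μ.prod γ)
        + c * ∫ p, g i (y p) * p.2 i ∂μ.prod γ) := by
      have : ∀ p : Ω × ℍ, fderiv ℝ h (y p) (-s • W p.1 + c • p.2) =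
          ∑ i, (-s * (W p.1 i * g i (y p)) + c * (g i (y p) * p.2 i)) := by
        intro p
        have hx : ∀ x : ℍ, fderiv ℝ h (y p) x = ∑ i, x i * g i (y p) := fun x => by
          have := congrArg (fderiv ℝ h (y p)) ((EuclideanSpace.basisFun (Fin n) ℝ).sum_repr x)
          rw [map_sum] at this
          simpa [g, e] using this.symm
        rw [hx]
        refine Finset.sum_congr rfl fun i _ => ?_
        simp only [PiLp.add_apply, PiLp.smul_apply, smul_eq_mul]
        ring
      show ∫ p, fderiv ℝ h (y p) (-s • W p.1 + c • p.2) ∂μ.prod γ = _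
      simp only [this]
      have hI4 : ∀ i, Integrable (fun p : Ω × ℍ => -s * (W p.1 i * g i (y p))
          + c * (g i (y p) * p.2 i)) (μ.prod γ) := fun i =>
        ((hI1 i).const_mul _).add ((hI2 i i).const_mul _)
      rw [integral_finsetSum _ fun i _ => hI4 i]
      refine Finset.sum_congr rfl fun i _ => ?_
      rw [integral_add ((hI1 i).const_mul _) ((hI2 i i).const_mul _), integral_const_mul,
        integral_const_mul]
    -- Both contributions now carry the factor `cos θ` and the weight `g i * Z_j`, so the kernel is
    -- compared directly with the identity matrix.
    have e2 : Φ' θ = ∑ i, ∑ j, c * ∫ p, ((if i = j then 1 else 0) - T i j p.1) *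
        (g i (y p) * p.2 j) ∂μ.prod γ := by
      rw [e1]
      refine Finset.sum_congr rfl fun i _ => ?_
      rw [neg_mul, hT.integral_interpolation hWm hW (hg i) (hg0 i) (hg1 i) i c s]
      have : ∀ j, ∫ p, ((if i = j then 1 else 0) - T i j p.1) * (g i (y p) * p.2 j) ∂μ.prod γ =
          (if i = j then ∫ p, g i (y p) * p.2 j ∂μ.prod γ else 0)
            - ∫ p, T i j p.1 * (g i (y p) * p.2 j) ∂μ.prod γ := fun j => by
        simp only [sub_mul]
        rw [integral_sub ((hI2 i j).const_mul _) (hI3 i j), integral_const_mul]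
        split_ifs <;> simp
      simp only [this]
      rw [← Finset.mul_sum, Finset.sum_sub_distrib, Finset.sum_ite_eq]
      simp only [Finset.mem_univ, if_true]
      ring
    rw [e2]
    refine (Finset.abs_sum_le_sum_abs _ _).trans (Finset.sum_le_sum fun i _ => ?_)
    refine (Finset.abs_sum_le_sum_abs _ _).trans (Finset.sum_le_sum fun j _ => ?_)
    rw [abs_mul]
    refine (mul_le_of_le_one_left (abs_nonneg _) (Real.abs_cos_le_one θ)).trans ?_
    have hTi : Integrable (fun ω => |T i j ω - if i = j then 1 else 0|) μ :=
      ((hT.integrable i j).sub (integrable_const _)).norm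
    calc |∫ p, ((if i = j then 1 else 0) - T i j p.1) * (g i (y p) * p.2 j) ∂μ.prod γ|
        ≤ ∫ p, |T i j p.1 - if i = j then 1 else 0| * |p.2 j| ∂μ.prod γ := by
          rw [← Real.norm_eq_abs]
          refine norm_integral_le_of_norm_le (hTi.mul_prod (hid j).norm) (.of_forall fun p => ?_)
          rw [norm_mul, norm_mul, Real.norm_eq_abs, Real.norm_eq_abs, Real.norm_eq_abs, abs_sub_comm]
          exact mul_le_mul_of_nonneg_left (mul_le_of_le_one_left (abs_nonneg _) (hg0 i _))
            (abs_nonneg _)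
      _ = (∫ ω, |T i j ω - if i = j then 1 else 0| ∂μ) * ∫ z : ℍ, |z j| ∂γ :=
          integral_prod_mul (fun ω => |T i j ω - if i = j then 1 else 0|) (fun z : ℍ => |z j|)
      _ ≤ _ := mul_le_of_le_one_right (integral_nonneg fun _ => abs_nonneg _)
          (integral_abs_coord_stdGaussian_le j)
  have h0 : Φ 0 = ∫ ω, h (W ω) ∂μ := by
    simp only [Φ, Real.cos_zero, Real.sin_zero, one_smul, zero_smul, add_zero]
    rw [integral_fun_fst (fun ω => h (W ω))]
    simp
  have hpi : Φ (Real.pi / 2) = ∫ z, h z ∂γ := by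
    simp only [Φ, Real.cos_pi_div_two, Real.sin_pi_div_two, one_smul, zero_smul, zero_add]
    rw [integral_fun_snd (fun z => h z)]
    simp
  rw [← h0, ← hpi, abs_sub_comm]
  have := Convex.norm_image_sub_le_of_norm_hasDerivWithin_le (f := Φ) (f' := Φ') (C := B)
    (s := Set.univ) (x := 0) (y := Real.pi / 2) (fun θ _ => (hΦ θ).hasDerivWithinAt)
    (fun θ _ => hΦ' θ) convex_univ trivial trivial
  rw [sub_zero, Real.norm_of_nonneg Real.pi_div_two_pos.le, mul_comm] at this
  exact this

/-- A random vector with a Stein kernel close to the identity is close to the standard Gaussian in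
Wasserstein distance. -/
theorem IsSteinKernel.wasserstein1_le {W : Ω → ℍ} {T : Fin n → Fin n → Ω → ℝ}
    (hT : IsSteinKernel μ W T) (hWm : Measurable W) (hW : Integrable W μ) :
    wasserstein1 (μ.map W) (stdGaussian ℍ) ≤
      ENNReal.ofReal
        (Real.pi / 2 * ∑ i, ∑ j, ∫ ω, |T i j ω - if i = j then 1 else 0| ∂μ) := by
  refine iSup_le fun f => iSup_le fun hf => iSup_le fun hf1 => iSup_le fun hf2 =>
    ENNReal.ofReal_le_ofReal (le_of_forall_pos_le_add fun ε hε => ?_)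
  obtain ⟨h, M, hh, hclose, h₁, h₂⟩ := hf.exists_smooth_approx (half_pos hε)
  have : IsProbabilityMeasure (μ.map W) := Measure.isProbabilityMeasure_map hWm.aemeasurable
  have key : ∀ ν : Measure ℍ, IsProbabilityMeasure ν → Integrable f ν →
      |(∫ x, f x ∂ν) - ∫ x, h x ∂ν| ≤ ε / 2 := by
    intro ν hν hfν
    have hd : Integrable (fun x => h x - f x) ν :=
      (integrable_const (ε / 2)).mono' (hh.continuous.sub hf.continuous).aestronglyMeasurable
        (.of_forall hclose)
    have hhν : Integrable h ν := (hd.add hfν).congr (.of_forall fun x => by simp)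
    rw [abs_sub_comm, ← integral_sub hhν hfν]
    simpa using norm_integral_le_of_norm_le_const (μ := ν) (f := fun x => h x - f x)
      (.of_forall hclose)
  have k1 := key _ this hf1
  have k2 := key _ inferInstance hf2
  have k3 := hT.abs_integral_sub_le hWm hW hh h₁ h₂
  rw [integral_map (φ := W) hWm.aemeasurable (f := h) hh.continuous.aestronglyMeasurable] at k1
  rw [abs_le] at *
  constructor <;> linarith [k1.1, k1.2, k2.1, k2.2, k3.1, k3.2]

end Stein

/-! ### Traces, Frobenius norms and moments of quadratic forms on the sphere. -/

section Features

variable {d : ℕ}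

local notation "𝔼" => EuclideanSpace ℝ (Fin d)

/-- The trace of an operator. -/
noncomputable def opTrace (S : 𝔼 →L[ℝ] 𝔼) : ℝ := LinearMap.trace ℝ 𝔼 S.toLinearMap

lemma opTrace_eq_sum (S : 𝔼 →L[ℝ] 𝔼) :
    opTrace S = ∑ k, ⟪EuclideanSpace.basisFun (Fin d) ℝ k,
      S (EuclideanSpace.basisFun (Fin d) ℝ k)⟫ :=
  LinearMap.trace_eq_sum_inner _ _

lemma opTrace_mul_comm (A B : 𝔼 →L[ℝ] 𝔼) : opTrace (A * B) = opTrace (B * A) :=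
  LinearMap.trace_mul_comm ℝ A.toLinearMap B.toLinearMap

/-- The square of the Frobenius norm of an operator. -/
noncomputable def frobSq (A : 𝔼 →L[ℝ] 𝔼) : ℝ := ∑ k, ‖A (EuclideanSpace.basisFun (Fin d) ℝ k)‖ ^ 2

lemma frobSq_eq_opTrace (A : 𝔼 →L[ℝ] 𝔼) : frobSq A = opTrace (A.adjoint * A) := by
  rw [opTrace_eq_sum, frobSq]
  refine Finset.sum_congr rfl fun k _ => ?_
  rw [mul_apply_eq_comp, ContinuousLinearMap.adjoint_inner_right,
    real_inner_self_eq_norm_sq]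

lemma frobSq_adjoint (A : 𝔼 →L[ℝ] 𝔼) : frobSq A.adjoint = frobSq A := by
  rw [frobSq_eq_opTrace, frobSq_eq_opTrace, ContinuousLinearMap.adjoint_adjoint, opTrace_mul_comm]

/-- Each diagonal term is `⟪A* b_k, A b_k⟫`, at most the mean of the two squared norms, and `A*` and
`A` have equal Frobenius norm. -/
lemma opTrace_mul_self_le (A : 𝔼 →L[ℝ] 𝔼) : opTrace (A * A) ≤ frobSq A := by
  have h : opTrace (A * A) ≤ (frobSq A.adjoint + frobSq A) / 2 := by
    rw [opTrace_eq_sum, frobSq, frobSq, ← Finset.sum_add_distrib, Finset.sum_div]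
    refine Finset.sum_le_sum fun k _ => ?_
    rw [mul_apply_eq_comp, ← ContinuousLinearMap.adjoint_inner_left]
    refine (real_inner_le_norm _ _).trans ?_
    nlinarith [sq_nonneg (‖A.adjoint (EuclideanSpace.basisFun (Fin d) ℝ k)‖ -
      ‖A (EuclideanSpace.basisFun (Fin d) ℝ k)‖)]
  rw [frobSq_adjoint] at h
  linarith

lemma frobSq_mul_le (A B : 𝔼 →L[ℝ] 𝔼) : frobSq (A * B) ≤ ‖A‖ ^ 2 * frobSq B := by
  rw [frobSq, frobSq, Finset.mul_sum]
  refine Finset.sum_le_sum fun k _ => ?_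
  rw [mul_apply_eq_comp, ← mul_pow]
  exact pow_le_pow_left₀ (norm_nonneg _) (A.le_opNorm _) 2

lemma frobSq_le (A : 𝔼 →L[ℝ] 𝔼) : frobSq A ≤ d * ‖A‖ ^ 2 := by
  have h : ∀ k : Fin d, ‖A (EuclideanSpace.basisFun (Fin d) ℝ k)‖ ^ 2 ≤ ‖A‖ ^ 2 := fun k => by
    refine pow_le_pow_left₀ (norm_nonneg _) ((A.le_opNorm _).trans_eq ?_) 2
    simp
  calc frobSq A ≤ ∑ _k : Fin d, ‖A‖ ^ 2 := Finset.sum_le_sum fun k _ => h k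
    _ = _ := by simp

lemma contDiff_quadForm (S : 𝔼 →L[ℝ] 𝔼) {n : WithTop ℕ∞} : ContDiff ℝ n fun x : 𝔼 => ⟪x, S x⟫ :=
  contDiff_id.inner ℝ S.contDiff

lemma fderiv_quadForm (S : 𝔼 →L[ℝ] 𝔼) (x v : 𝔼) :
    fderiv ℝ (fun x : 𝔼 => ⟪x, S x⟫) x v = ⟪x, S v⟫ + ⟪v, S x⟫ := by
  rw [fderiv_inner_apply ℝ differentiableAt_fun_id S.differentiableAt]
  simp

lemma fderiv_inner_const (u x v : 𝔼) : fderiv ℝ (fun x : 𝔼 => ⟪u, x⟫) x v = ⟪u, v⟫ := by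
  have : HasFDerivAt (fun x : 𝔼 => ⟪u, x⟫) (innerSL ℝ u) x := (innerSL ℝ u).hasFDerivAt
  rw [this.fderiv, innerSL_apply_apply]

/-- The Stein identity of the sphere for quadratic forms. -/
lemma integral_quadForm_mul_unifSphere (hd : 1 ≤ d) (S : 𝔼 →L[ℝ] 𝔼) {g : 𝔼 → ℝ}
    (hg : ContDiff ℝ 1 g) :
    d * ∫ x, ⟪x, S x⟫ * g x ∂unifSphere d =
      ∫ x, (d * (opTrace S * g x) + d * fderiv ℝ g x (S x)
        - ⟪x, S x⟫ * fderiv ℝ g x x) ∂unifSphere d := by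
  let b := EuclideanSpace.basisFun (Fin d) ℝ
  have hcg := hg.continuous
  have hdg : Continuous (fderiv ℝ g) := hg.continuous_fderiv one_ne_zero
  have c1 : ∀ k, Continuous fun x => fderiv ℝ g x (b k) := fun k => hdg.clm_apply continuous_const
  have c2 : Continuous fun x => fderiv ℝ g x x := hdg.clm_apply continuous_id
  have c3 : Continuous fun x => fderiv ℝ g x (S x) := hdg.clm_apply S.continuous
  have hfd : ∀ k x v, fderiv ℝ (fun y => ⟪b k, S y⟫ * g y) x v =
      ⟪b k, S x⟫ * fderiv ℝ g x v + g x * ⟪b k, S v⟫ := by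
    intro k x v
    have h1 : HasFDerivAt (fun y => ⟪b k, S y⟫) ((innerSL ℝ (b k)).comp S) x :=
      ((innerSL ℝ (b k)).comp S).hasFDerivAt
    rw [(h1.fun_mul (hg.differentiable one_ne_zero x).hasFDerivAt).fderiv]
    simp
  -- Writing `⟪x, S x⟫ = ∑ ⟪b k, x⟫ * ⟪b k, S x⟫`, the linear identity is applied to the first
  -- factor with the second one attached to `g`.
  have hcd : ∀ k, ContDiff ℝ 1 fun y => ⟪b k, S y⟫ * g y := fun k =>
    (contDiff_const.inner ℝ S.contDiff).mul hg
  have hk := fun k => integral_inner_mul_unifSphere hd (hcd k) (b k)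
  have hs : ∑ k, ((d : ℝ) - 1) * ∫ x, ⟪b k, x⟫ * (⟪b k, S x⟫ * g x) ∂unifSphere d = _ :=
    Finset.sum_congr rfl fun k _ => hk k
  simp only [hfd] at hs
  have e0 : ∀ x y : 𝔼, ∑ k, ⟪b k, x⟫ * ⟪b k, y⟫ = ⟪x, y⟫ := fun x y => by
    rw [← b.sum_inner_mul_inner x y]
    exact Finset.sum_congr rfl fun k _ => by rw [real_inner_comm x]
  have e1 : ∀ x v, ∑ k, ⟪b k, v⟫ * fderiv ℝ g x (b k) = fderiv ℝ g x v := fun x v => by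
    have := congrArg (fderiv ℝ g x) (b.sum_repr' v)
    rw [map_sum] at this
    simpa only [map_smul, smul_eq_mul] using this
  rw [← Finset.mul_sum, ← integral_finsetSum _ fun k _ =>
      integrable_unifSphere_of_continuous hd (by fun_prop),
    ← integral_finsetSum _ fun k _ =>
      integrable_unifSphere_of_continuous hd (by fun_prop)] at hs
  have l1 : ∀ x, ∑ k, ⟪b k, x⟫ * (⟪b k, S x⟫ * g x) = ⟪x, S x⟫ * g x := fun x => by
    rw [← e0, Finset.sum_mul]
    exact Finset.sum_congr rfl fun k _ => by ring
  -- The radial derivative of the linear factor `⟪b k, S x⟫` gives back the form itself; this extra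
  -- term turns the coefficient `d - 1` into `d`.
  have l2 : ∀ x, ∑ k, (d * (⟪b k, S x⟫ * fderiv ℝ g x (b k) + g x * ⟪b k, S (b k)⟫) -
        ⟪b k, x⟫ * (⟪b k, S x⟫ * fderiv ℝ g x x + g x * ⟪b k, S x⟫)) =
      (d * (opTrace S * g x) + d * fderiv ℝ g x (S x) - ⟪x, S x⟫ * fderiv ℝ g x x)
        - ⟪x, S x⟫ * g x := fun x => by
    rw [opTrace_eq_sum, ← e1 x (S x), ← e0 x (S x), Finset.sum_mul, Finset.sum_mul, Finset.sum_mul,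
      Finset.mul_sum, Finset.mul_sum, ← Finset.sum_add_distrib, ← Finset.sum_sub_distrib,
      ← Finset.sum_sub_distrib]
    exact Finset.sum_congr rfl fun k _ => by ring
  simp only [l1, l2] at hs
  rw [integral_sub (integrable_unifSphere_of_continuous hd (by fun_prop))
    (integrable_unifSphere_of_continuous hd (by fun_prop))] at hs
  linarith

lemma integral_quadForm_unifSphere (hd : 1 ≤ d) (S : 𝔼 →L[ℝ] 𝔼) :
    ∫ x, ⟪x, S x⟫ ∂unifSphere d = opTrace S := by
  have := isProbabilityMeasure_unifSphere hd
  have hd0 : (d : ℝ) ≠ 0 := by positivity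
  have h := integral_quadForm_mul_unifSphere hd S (g := fun _ => 1) contDiff_const
  simp only [mul_one, fderiv_fun_const, Pi.zero_apply, zero_apply, mul_zero, add_zero,
    sub_zero, integral_const, probReal_univ, one_smul] at h
  exact mul_left_cancel₀ hd0 h

lemma integral_inner_sq_unifSphere (hd : 1 ≤ d) (u : 𝔼) :
    ∫ x, ⟪u, x⟫ ^ 2 ∂unifSphere d = ‖u‖ ^ 2 := by
  have := isProbabilityMeasure_unifSphere hd
  have hd0 : (d : ℝ) ≠ 0 := by positivity
  have hu : ContDiff ℝ 1 fun x : 𝔼 => ⟪u, x⟫ := (innerSL ℝ u).contDiff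
  have h := integral_inner_mul_unifSphere hd hu u
  simp only [fderiv_inner_const, real_inner_self_eq_norm_sq, ← sq] at h
  rw [integral_sub (integrable_const _) (integrable_unifSphere_of_continuous hd (by fun_prop))] at h
  simp only [integral_const, probReal_univ, one_smul] at h
  refine mul_left_cancel₀ hd0 ?_
  linarith

/-- The Stein identity for `A` is tested on the form of `B`. Homogeneity of degree two makes the
radial term twice the integrand, whence the factor `d + 2`. -/
lemma integral_quadForm_mul_quadForm_unifSphere (hd : 1 ≤ d) (A B : 𝔼 →L[ℝ] 𝔼) :
    (d + 2) * ∫ x, ⟪x, A x⟫ * ⟪x, B x⟫ ∂unifSphere d =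
      d * (opTrace A * opTrace B + opTrace (B * A) + opTrace (A.adjoint * B)) := by
  have := isProbabilityMeasure_unifSphere hd
  have h := integral_quadForm_mul_unifSphere hd A (contDiff_quadForm B)
  have e : ∀ x : 𝔼, d * (opTrace A * ⟪x, B x⟫) + d * fderiv ℝ (fun x : 𝔼 => ⟪x, B x⟫) x (A x)
        - ⟪x, A x⟫ * fderiv ℝ (fun x : 𝔼 => ⟪x, B x⟫) x x =
      (d * (opTrace A * ⟪x, B x⟫ + ⟪x, (B * A) x⟫ + ⟪x, (A.adjoint * B) x⟫))
        - 2 * (⟪x, A x⟫ * ⟪x, B x⟫) := fun x => by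
    rw [fderiv_quadForm, fderiv_quadForm, mul_apply_eq_comp,
      mul_apply_eq_comp, ContinuousLinearMap.adjoint_inner_right]
    ring
  have I : ∀ F : 𝔼 → ℝ, Continuous F → Integrable F (unifSphere d) := fun F hF =>
    integrable_unifSphere_of_continuous hd hF
  simp only [e] at h
  rw [integral_sub (I _ (by fun_prop)) (I _ (by fun_prop)), integral_const_mul, integral_const_mul,
    integral_add (I _ (by fun_prop)) (I _ (by fun_prop)),
    integral_add (I _ (by fun_prop)) (I _ (by fun_prop)), integral_const_mul,
    integral_quadForm_unifSphere hd, integral_quadForm_unifSphere hd,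
    integral_quadForm_unifSphere hd] at h
  linarith

/-- The second moment is `d / (d + 2)` times `(tr M)² + tr(M²) + ‖M‖_F²`. Dropping this factor,
which is below one, leaves the square of the mean plus at most `2 ‖M‖_F²`. -/
lemma integral_quadForm_sub_opTrace_sq_le (hd : 1 ≤ d) (M : 𝔼 →L[ℝ] 𝔼) :
    ∫ x, (⟪x, M x⟫ - opTrace M) ^ 2 ∂unifSphere d ≤ 2 * frobSq M := by
  have := isProbabilityMeasure_unifSphere hd
  have h := integral_quadForm_mul_quadForm_unifSphere hd M M
  rw [← frobSq_eq_opTrace] at h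
  have h2 := opTrace_mul_self_le M
  have I : ∀ F : 𝔼 → ℝ, Continuous F → Integrable F (unifSphere d) := fun F hF =>
    integrable_unifSphere_of_continuous hd hF
  have e : ∫ x, (⟪x, M x⟫ - opTrace M) ^ 2 ∂unifSphere d =
      (∫ x, ⟪x, M x⟫ * ⟪x, M x⟫ ∂unifSphere d) - opTrace M ^ 2 := by
    have : ∀ x : 𝔼, (⟪x, M x⟫ - opTrace M) ^ 2 =
        (⟪x, M x⟫ * ⟪x, M x⟫ - 2 * opTrace M * ⟪x, M x⟫) + opTrace M ^ 2 := fun x => by ring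
    simp only [this]
    rw [integral_add (I _ (by fun_prop)) (integrable_const _),
      integral_sub (I _ (by fun_prop)) (I _ (by fun_prop)), integral_const_mul,
      integral_quadForm_unifSphere hd]
    simp
    ring
  rw [e]
  set Q := ∫ x, ⟪x, M x⟫ * ⟪x, M x⟫ ∂unifSphere d
  have hF : 0 ≤ frobSq M := Finset.sum_nonneg fun _ _ => sq_nonneg _
  have hd0 : (0 : ℝ) ≤ d := by positivity
  have h3 : (d + 2) * Q ≤ (d + 2) * (opTrace M ^ 2 + 2 * frobSq M) := by
    nlinarith [sq_nonneg (opTrace M)]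
  have := le_of_mul_le_mul_left h3 (by positivity)
  linarith

/-- Integrate `|F| ≤ F² / (2ε) + ε / 2`, which is `(|F| - ε)² ≥ 0`; no square roots are needed. -/
lemma integral_abs_le_of_integral_sq_le (hd : 1 ≤ d) {F : 𝔼 → ℝ} (hF : Continuous F) {K ε : ℝ}
    (hε : 0 < ε) (h : ∫ x, F x ^ 2 ∂unifSphere d ≤ K * ε ^ 2) :
    ∫ x, |F x| ∂unifSphere d ≤ (K + 1) / 2 * ε := by
  have := isProbabilityMeasure_unifSphere hd
  have hi : Integrable (fun x => F x ^ 2) (unifSphere d) :=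
    integrable_unifSphere_of_continuous hd (by fun_prop)
  calc ∫ x, |F x| ∂unifSphere d ≤ ∫ x, (1 / (2 * ε) * F x ^ 2 + ε / 2) ∂unifSphere d := by
        refine integral_mono (integrable_unifSphere_of_continuous hd hF.abs)
          ((hi.const_mul _).add (integrable_const _)) fun x => ?_
        have h1 : 1 / (2 * ε) * F x ^ 2 + ε / 2 - |F x| = (|F x| - ε) ^ 2 / (2 * ε) := by
          rw [← sq_abs (F x)]; field_simp; ring
        have h2 : 0 ≤ (|F x| - ε) ^ 2 / (2 * ε) := by positivity
        show |F x| ≤ 1 / (2 * ε) * F x ^ 2 + ε / 2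
        linarith
    _ = 1 / (2 * ε) * (∫ x, F x ^ 2 ∂unifSphere d) + ε / 2 := by
        rw [integral_add (hi.const_mul _) (integrable_const _), integral_const_mul]
        simp
    _ ≤ 1 / (2 * ε) * (K * ε ^ 2) + ε / 2 := by gcongr
    _ = _ := by field_simp

end Features

/-! ### Stein fields on the sphere and the kernels they induce. -/

section SteinField

variable {d : ℕ}

local notation "𝔼" => EuclideanSpace ℝ (Fin d)

/-- A vector field `V` such that testing against the function `w` on the sphere amounts to
differentiating along `V`. -/
structure IsSteinField (w : 𝔼 → ℝ) (V : 𝔼 → 𝔼) : Prop where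
  contDiff : ContDiff ℝ 1 w
  continuous : Continuous V
  integral_mul_eq : ∀ g : 𝔼 → ℝ, ContDiff ℝ 1 g →
    ∫ x, w x * g x ∂unifSphere d = ∫ x, fderiv ℝ g x (V x) ∂unifSphere d

/-- The Stein field of a quadratic form. -/
noncomputable def quadField (S : 𝔼 →L[ℝ] 𝔼) (x : 𝔼) : 𝔼 := S x - (⟪x, S x⟫ / d) • x

/-- The Stein field of a linear form. -/
noncomputable def linField (u x : 𝔼) : 𝔼 := ((d : ℝ) - 1)⁻¹ • ((d : ℝ) • u - ⟪u, x⟫ • x)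

/-- Vanishing trace removes the zeroth-order term `tr S * g`, leaving a pure derivative. -/
lemma isSteinField_quadField (hd : 1 ≤ d) {S : 𝔼 →L[ℝ] 𝔼} (hS : opTrace S = 0) :
    IsSteinField (fun x => ⟪x, S x⟫) (quadField S) where
  contDiff := contDiff_quadForm S
  continuous := by unfold quadField; fun_prop
  integral_mul_eq g hg := by
    have hd0 : (d : ℝ) ≠ 0 := by positivity
    refine mul_left_cancel₀ hd0 ?_
    rw [integral_quadForm_mul_unifSphere hd S hg, ← integral_const_mul]
    refine integral_congr_ae (.of_forall fun x => ?_)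
    simp only [hS, quadField, map_sub, map_smul, smul_eq_mul]
    field_simp
    ring

lemma isSteinField_linField (hd : 2 ≤ d) (u : 𝔼) :
    IsSteinField (fun x => ⟪u, x⟫) (linField u) where
  contDiff := (innerSL ℝ u).contDiff
  continuous := by unfold linField; fun_prop
  integral_mul_eq g hg := by
    have hd0 : (d : ℝ) - 1 ≠ 0 := by
      have : (2 : ℝ) ≤ d := by exact_mod_cast hd
      linarith
    refine mul_left_cancel₀ hd0 ?_
    rw [integral_inner_mul_unifSphere (by omega) hg, ← integral_const_mul]
    refine integral_congr_ae (.of_forall fun x => ?_)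
    simp only [linField, map_sub, map_smul, smul_eq_mul]
    field_simp

/-- Test the field `V i` on `g ∘ W`: by the chain rule, `∂_{V_i} (g ∘ W) = ∑_j ∂_{V_i} w_j * ∂_j
g(W)`. -/
lemma isSteinKernel_of_isSteinField (hd : 1 ≤ d) {n : ℕ} {w : Fin n → 𝔼 → ℝ} {V : Fin n → 𝔼 → 𝔼}
    (hwV : ∀ i, IsSteinField (w i) (V i)) :
    IsSteinKernel (unifSphere d) (fun x => (WithLp.toLp 2 fun i => w i x : EuclideanSpace ℝ (Fin n)))
      (fun i j x => fderiv ℝ (w j) x (V i x)) where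
  integrable i j := integrable_unifSphere_of_continuous hd
    (((hwV j).contDiff.continuous_fderiv one_ne_zero).clm_apply (hwV i).continuous)
  integral_mul_eq g hg i := by
    let W : 𝔼 → EuclideanSpace ℝ (Fin n) := fun x => WithLp.toLp 2 fun i => w i x
    have hW : ContDiff ℝ 1 W := contDiff_piLp 2 |>.2 fun i => (hwV i).contDiff
    refine ((hwV i).integral_mul_eq (fun x => g (W x)) (hg.comp hW)).trans ?_
    refine integral_congr_ae (.of_forall fun x => ?_)
    have hWd := hW.differentiable one_ne_zero x
    have h1 : ∀ v j, fderiv ℝ W x v j = fderiv ℝ (w j) x v := fun v j => by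
      have h : HasFDerivAt (w j) ((EuclideanSpace.proj j).comp (fderiv ℝ W x)) x :=
        (EuclideanSpace.proj (𝕜 := ℝ) j).hasFDerivAt.comp x hWd.hasFDerivAt
      rw [h.fderiv]; rfl
    have h2 := ((hg.differentiable one_ne_zero (W x)).hasFDerivAt.comp x hWd.hasFDerivAt).fderiv
    have h3 := congrArg (fderiv ℝ g (W x))
      ((EuclideanSpace.basisFun (Fin n) ℝ).sum_repr (fderiv ℝ W x (V i x)))
    rw [map_sum] at h3
    simp only [Function.comp_def] at h2
    simp only [h2]
    rw [ContinuousLinearMap.comp_apply, ← h3]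
    simp [h1, W]

/-- Gaussian approximation for functions on the sphere that have Stein fields. -/
theorem wasserstein1_le_of_isSteinField (hd : 1 ≤ d) {n : ℕ} {w : Fin n → 𝔼 → ℝ}
    {V : Fin n → 𝔼 → 𝔼} (hwV : ∀ i, IsSteinField (w i) (V i)) {B : ℝ}
    (hB : ∀ i j, ∫ x, |fderiv ℝ (w j) x (V i x) - if i = j then 1 else 0| ∂unifSphere d ≤ B) :
    wasserstein1 ((unifSphere d).map
        fun x => (WithLp.toLp 2 fun i => w i x : EuclideanSpace ℝ (Fin n)))
      (stdGaussian (EuclideanSpace ℝ (Fin n))) ≤ ENNReal.ofReal (Real.pi / 2 * (n ^ 2 * B)) := by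
  have := isProbabilityMeasure_unifSphere hd
  have hW : Continuous fun x => (WithLp.toLp 2 fun i => w i x : EuclideanSpace ℝ (Fin n)) :=
    (contDiff_piLp 2 |>.2 fun i => (hwV i).contDiff : ContDiff ℝ 1 _).continuous
  have hWi : Integrable (fun x => (WithLp.toLp 2 fun i => w i x : EuclideanSpace ℝ (Fin n)))
      (unifSphere d) := by
    rw [← integrable_norm_iff hW.aestronglyMeasurable]
    exact integrable_unifSphere_of_continuous hd hW.norm
  refine ((isSteinKernel_of_isSteinField hd hwV).wasserstein1_le hW.measurable hWi).trans
    (ENNReal.ofReal_le_ofReal (mul_le_mul_of_nonneg_left ?_ Real.pi_div_two_pos.le))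
  calc _ ≤ ∑ _i : Fin n, ∑ _j : Fin n, B :=
        Finset.sum_le_sum fun i _ => Finset.sum_le_sum fun j _ => hB i j
    _ = n ^ 2 * B := by simp; ring

/-! ### `L¹` distance of the kernel entries from the identity matrix. -/

section Bounds

variable {S R : EuclideanSpace ℝ (Fin d) →L[ℝ] EuclideanSpace ℝ (Fin d)}
  {u v : EuclideanSpace ℝ (Fin d)} {ε δ : ℝ}

lemma integral_abs_mul_le_one (hd : 1 ≤ d) {f g : 𝔼 → ℝ} (hf : Continuous f) (hg : Continuous g)
    (hf1 : ∫ x, f x ^ 2 ∂unifSphere d = 1) (hg1 : ∫ x, g x ^ 2 ∂unifSphere d = 1) :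
    ∫ x, |f x * g x| ∂unifSphere d ≤ 1 := by
  have I : ∀ F : 𝔼 → ℝ, Continuous F → Integrable F (unifSphere d) := fun F hF =>
    integrable_unifSphere_of_continuous hd hF
  calc ∫ x, |f x * g x| ∂unifSphere d ≤ ∫ x, (f x ^ 2 + g x ^ 2) / 2 ∂unifSphere d := by
        refine integral_mono (I _ (by fun_prop)) (I _ (by fun_prop)) fun x => ?_
        show |f x * g x| ≤ (f x ^ 2 + g x ^ 2) / 2
        rw [abs_mul, ← sq_abs (f x), ← sq_abs (g x)]
        nlinarith [sq_nonneg (|f x| - |g x|)]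
    _ = 1 := by
        rw [integral_div, integral_add (I _ (by fun_prop)) (I _ (by fun_prop)), hf1, hg1]
        norm_num

/-- The entry minus `δ` splits into twice the centred form of `R * S`, the mean defect `2δ/d`, and
`2/d` times a product of two normalised features. The first costs `3ε` by the variance bound, and
the other two cost `4/d ≤ 8ε`. -/
lemma integral_abs_fderiv_quad_quad_le (hd : 2 ≤ d) (hR : ∀ x y, ⟪R x, y⟫ = ⟪x, R y⟫)
    (hRε : ‖R‖ ≤ ε) (hε : 0 < ε) (hdε : 1 / d ≤ 2 * ε)
    (hS1 : ∫ x, ⟪x, S x⟫ ^ 2 ∂unifSphere d = 1) (hR1 : ∫ x, ⟪x, R x⟫ ^ 2 ∂unifSphere d = 1)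
    (hF : frobSq S ≤ 1) (hδ : 2 * opTrace (R * S) = δ * (1 + 2 / d)) (hδ1 : |δ| ≤ 1) :
    ∫ x, |fderiv ℝ (fun x : 𝔼 => ⟪x, R x⟫) x (quadField S x) - δ| ∂unifSphere d ≤ 12 * ε := by
  have hd1 : 1 ≤ d := by omega
  have := isProbabilityMeasure_unifSphere hd1
  have hd0 : (0 : ℝ) < d := by positivity
  have I : ∀ F : 𝔼 → ℝ, Continuous F → Integrable F (unifSphere d) := fun F hF =>
    integrable_unifSphere_of_continuous hd1 hF
  have h1 : ∫ x, |⟪x, (R * S) x⟫ - opTrace (R * S)| ∂unifSphere d ≤ (2 + 1) / 2 * ε := by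
    refine integral_abs_le_of_integral_sq_le (K := 2)
      (F := fun x => ⟪x, (R * S) x⟫ - opTrace (R * S)) hd1 (by fun_prop) hε ?_
    refine (integral_quadForm_sub_opTrace_sq_le hd1 _).trans ?_
    refine mul_le_mul_of_nonneg_left ((frobSq_mul_le R S).trans ?_) zero_le_two
    calc ‖R‖ ^ 2 * frobSq S ≤ ε ^ 2 * 1 := by
          gcongr
          exact Finset.sum_nonneg fun _ _ => sq_nonneg _
      _ = ε ^ 2 := mul_one _
  have h2 := integral_abs_mul_le_one hd1 (f := fun x => ⟪x, S x⟫) (g := fun x => ⟪x, R x⟫)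
    (by fun_prop) (by fun_prop) hS1 hR1
  have e : ∀ x : 𝔼, fderiv ℝ (fun x : 𝔼 => ⟪x, R x⟫) x (quadField S x) - δ =
      2 * (⟪x, (R * S) x⟫ - opTrace (R * S)) + 2 / d * δ - 2 / d * (⟪x, S x⟫ * ⟪x, R x⟫) := by
    intro x
    rw [fderiv_quadForm, ← real_inner_comm (quadField S x), hR, quadField, map_sub, map_smul,
      inner_sub_right, real_inner_smul_right, mul_apply_eq_comp]
    linear_combination hδ
  have hb : ∀ x : 𝔼, |fderiv ℝ (fun x : 𝔼 => ⟪x, R x⟫) x (quadField S x) - δ| ≤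
      2 * |⟪x, (R * S) x⟫ - opTrace (R * S)| + 2 / d + 2 / d * |⟪x, S x⟫ * ⟪x, R x⟫| := by
    intro x
    rw [e]
    refine (abs_sub _ _).trans (add_le_add ((abs_add_le _ _).trans (add_le_add ?_ ?_)) ?_)
    · rw [abs_mul, abs_two]
    · rw [abs_mul, abs_of_pos (by positivity : 0 < 2 / (d : ℝ))]
      exact mul_le_of_le_one_right (by positivity) hδ1
    · rw [abs_mul, abs_of_pos (by positivity : 0 < 2 / (d : ℝ))]
  calc _ ≤ ∫ x, (2 * |⟪x, (R * S) x⟫ - opTrace (R * S)| + 2 / d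
          + 2 / d * |⟪x, S x⟫ * ⟪x, R x⟫|) ∂unifSphere d := by
        refine integral_mono_of_nonneg (.of_forall fun x => abs_nonneg _) (I _ (by fun_prop))
          (.of_forall hb)
    _ = 2 * (∫ x, |⟪x, (R * S) x⟫ - opTrace (R * S)| ∂unifSphere d) + 2 / d
          + 2 / d * ∫ x, |⟪x, S x⟫ * ⟪x, R x⟫| ∂unifSphere d := by
        rw [integral_add (I _ (by fun_prop)) (I _ (by fun_prop)),
          integral_add (I _ (by fun_prop)) (integrable_const _), integral_const_mul,
          integral_const_mul]
        simp
    _ ≤ 2 * ((2 + 1) / 2 * ε) + 2 / d + 2 / d * 1 := by gcongr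
    _ ≤ 12 * ε := by
        have : (2 : ℝ) / d = 2 * (1 / d) := by ring
        rw [this]; linarith

/-- The linear form `⟪u, S x⟫ = ⟪S u, x⟫` has second moment `‖S u‖² ≤ ε²`, and the product term
costs at most `1/d ≤ 2ε`. Up to a scalar factor this is the kernel entry in both mixed cases. -/
lemma integral_abs_cross_le (hd : 1 ≤ d) (hS : ∀ x y, ⟪S x, y⟫ = ⟪x, S y⟫) (hSε : ‖S‖ ≤ ε)
    (hε : 0 < ε) (hdε : 1 / d ≤ 2 * ε) (hS1 : ∫ x, ⟪x, S x⟫ ^ 2 ∂unifSphere d = 1) (hu : ‖u‖ = 1) :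
    ∫ x, |⟪u, S x⟫ - ⟪x, S x⟫ * ⟪u, x⟫ / d| ∂unifSphere d ≤ 3 * ε := by
  have := isProbabilityMeasure_unifSphere hd
  have hd0 : (0 : ℝ) < d := by positivity
  have I : ∀ F : 𝔼 → ℝ, Continuous F → Integrable F (unifSphere d) := fun F hF =>
    integrable_unifSphere_of_continuous hd hF
  have h1 : ∫ x, |⟪u, S x⟫| ∂unifSphere d ≤ (1 + 1) / 2 * ε := by
    refine integral_abs_le_of_integral_sq_le (K := 1) (F := fun x => ⟪u, S x⟫) hd (by fun_prop) hε ?_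
    simp only [← hS]
    rw [integral_inner_sq_unifSphere hd, one_mul]
    refine pow_le_pow_left₀ (norm_nonneg _) ((S.le_opNorm u).trans ?_) 2
    rwa [hu, mul_one]
  have h2 := integral_abs_mul_le_one hd (f := fun x => ⟪x, S x⟫) (g := fun x => ⟪u, x⟫)
    (by fun_prop) (by fun_prop) hS1 (by rw [integral_inner_sq_unifSphere hd, hu, one_pow])
  calc _ ≤ ∫ x, (|⟪u, S x⟫| + 1 / d * |⟪x, S x⟫ * ⟪u, x⟫|) ∂unifSphere d := by
        refine integral_mono_of_nonneg (.of_forall fun x => abs_nonneg _) (I _ (by fun_prop))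
          (.of_forall fun x => (abs_sub _ _).trans_eq ?_)
        rw [abs_div, abs_of_pos hd0]
        simp only
        ring
    _ = (∫ x, |⟪u, S x⟫| ∂unifSphere d) + 1 / d * ∫ x, |⟪x, S x⟫ * ⟪u, x⟫| ∂unifSphere d := by
        rw [integral_add (I _ (by fun_prop)) (I _ (by fun_prop)), integral_const_mul]
    _ ≤ (1 + 1) / 2 * ε + 1 / d * 1 := by gcongr
    _ ≤ 3 * ε := by linarith

lemma integral_abs_fderiv_lin_quad_le (hd : 1 ≤ d) (hS : ∀ x y, ⟪S x, y⟫ = ⟪x, S y⟫)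
    (hSε : ‖S‖ ≤ ε) (hε : 0 < ε) (hdε : 1 / d ≤ 2 * ε)
    (hS1 : ∫ x, ⟪x, S x⟫ ^ 2 ∂unifSphere d = 1) (hu : ‖u‖ = 1) :
    ∫ x, |fderiv ℝ (fun x : 𝔼 => ⟪u, x⟫) x (quadField S x)| ∂unifSphere d ≤ 12 * ε := by
  have h := integral_abs_cross_le hd hS hSε hε hdε hS1 hu
  have e : ∀ x : 𝔼, fderiv ℝ (fun x : 𝔼 => ⟪u, x⟫) x (quadField S x) =
      ⟪u, S x⟫ - ⟪x, S x⟫ * ⟪u, x⟫ / d := fun x => by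
    rw [fderiv_inner_const, quadField, inner_sub_right, real_inner_smul_right]
    ring
  simp only [e]
  linarith

lemma integral_abs_fderiv_quad_lin_le (hd : 2 ≤ d) (hS : ∀ x y, ⟪S x, y⟫ = ⟪x, S y⟫)
    (hSε : ‖S‖ ≤ ε) (hε : 0 < ε) (hdε : 1 / d ≤ 2 * ε)
    (hS1 : ∫ x, ⟪x, S x⟫ ^ 2 ∂unifSphere d = 1) (hu : ‖u‖ = 1) :
    ∫ x, |fderiv ℝ (fun x : 𝔼 => ⟪x, S x⟫) x (linField u x)| ∂unifSphere d ≤ 12 * ε := by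
  have h := integral_abs_cross_le (by omega) hS hSε hε hdε hS1 hu
  have hd2 : (2 : ℝ) ≤ d := by exact_mod_cast hd
  have hd1 : (0 : ℝ) < d - 1 := by linarith
  have e : ∀ x : 𝔼, fderiv ℝ (fun x : 𝔼 => ⟪x, S x⟫) x (linField u x) =
      2 * d / (d - 1) * (⟪u, S x⟫ - ⟪x, S x⟫ * ⟪u, x⟫ / d) := fun x => by
    rw [fderiv_quadForm, ← hS, real_inner_comm, linField, real_inner_smul_left, inner_sub_left,
      real_inner_smul_left, real_inner_smul_left]
    field_simp
    ring
  simp only [e, abs_mul]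
  rw [integral_const_mul, abs_of_nonneg (by positivity)]
  -- The two mixed entries differ by the factor `2d/(d - 1)`; here `4 * 3ε` dictates the common
  -- constant `12`.
  have h4 : 2 * (d : ℝ) / (d - 1) ≤ 4 := by rw [div_le_iff₀ hd1]; linarith
  calc _ ≤ 4 * (3 * ε) := by gcongr
    _ = 12 * ε := by ring

lemma integral_abs_fderiv_lin_lin_le (hd : 2 ≤ d) (hε : 0 < ε) (hdε : 1 / d ≤ 2 * ε)
    (hu : ‖u‖ = 1) (hv : ‖v‖ = 1) :
    ∫ x, |fderiv ℝ (fun x : 𝔼 => ⟪v, x⟫) x (linField u x) - ⟪u, v⟫| ∂unifSphere d ≤ 12 * ε := by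
  have hd1' : 1 ≤ d := by omega
  have := isProbabilityMeasure_unifSphere hd1'
  have hd2 : (2 : ℝ) ≤ d := by exact_mod_cast hd
  have hd1 : (0 : ℝ) < d - 1 := by linarith
  have I : ∀ F : 𝔼 → ℝ, Continuous F → Integrable F (unifSphere d) := fun F hF =>
    integrable_unifSphere_of_continuous hd1' hF
  have h2 := integral_abs_mul_le_one hd1' (f := fun x => ⟪u, x⟫) (g := fun x => ⟪v, x⟫)
    (by fun_prop) (by fun_prop) (by rw [integral_inner_sq_unifSphere hd1', hu, one_pow])
    (by rw [integral_inner_sq_unifSphere hd1', hv, one_pow])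
  have hδ : |⟪u, v⟫| ≤ 1 := by simpa [hu, hv] using abs_real_inner_le_norm u v
  have e : ∀ x : 𝔼, fderiv ℝ (fun x : 𝔼 => ⟪v, x⟫) x (linField u x) - ⟪u, v⟫ =
      ((d : ℝ) - 1)⁻¹ * (⟪u, v⟫ - ⟪u, x⟫ * ⟪v, x⟫) := fun x => by
    rw [fderiv_inner_const, linField, real_inner_smul_right, inner_sub_right,
      real_inner_smul_right, real_inner_smul_right, real_inner_comm v u]
    field_simp
    ring
  simp only [e, abs_mul ((d : ℝ) - 1)⁻¹]
  rw [integral_const_mul, abs_of_nonneg (by positivity)]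
  have h4 : ((d : ℝ) - 1)⁻¹ ≤ 2 * (1 / d) := by
    rw [inv_le_iff_one_le_mul₀ hd1, mul_one_div, ← sub_nonneg]
    have : 2 / (d : ℝ) * (d - 1) - 1 = (d - 2) / d := by field_simp; ring
    rw [this]
    exact div_nonneg (by linarith) (by linarith)
  have h5 : ∫ x, |⟪u, v⟫ - ⟪u, x⟫ * ⟪v, x⟫| ∂unifSphere d ≤ 2 := by
    calc _ ≤ ∫ x, (1 + |⟪u, x⟫ * ⟪v, x⟫|) ∂unifSphere d := by
          refine integral_mono_of_nonneg (.of_forall fun x => abs_nonneg _) (I _ (by fun_prop))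
            (.of_forall fun x => (abs_sub _ _).trans ?_)
          exact add_le_add_left hδ _
      _ = 1 + ∫ x, |⟪u, x⟫ * ⟪v, x⟫| ∂unifSphere d := by
          rw [integral_add (integrable_const _) (I _ (by fun_prop))]
          simp
      _ ≤ 2 := by linarith
  calc _ ≤ 2 * (2 * ε) * 2 := by gcongr; linarith
    _ ≤ 12 * ε := by linarith

end Bounds

end SteinField

/-! ### From matrices to symmetric operators; consequences of normalisation. -/

section MatrixFeatures

variable {d : ℕ}

/-- The self-adjoint operator with the same quadratic form as the matrix `A`. -/
noncomputable def symOp (A : Matrix (Fin d) (Fin d) ℝ) :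
    EuclideanSpace ℝ (Fin d) →L[ℝ] EuclideanSpace ℝ (Fin d) :=
  (1 / 2 : ℝ) • (Matrix.toEuclideanCLM (𝕜 := ℝ) A +
    ContinuousLinearMap.adjoint (Matrix.toEuclideanCLM (𝕜 := ℝ) A))

lemma symOp_adjoint (A : Matrix (Fin d) (Fin d) ℝ) :
    ContinuousLinearMap.adjoint (symOp A) = symOp A := by
  rw [symOp, map_smulₛₗ, map_add, ContinuousLinearMap.adjoint_adjoint, add_comm]
  simp

lemma inner_symOp_left (A : Matrix (Fin d) (Fin d) ℝ) (x y : EuclideanSpace ℝ (Fin d)) :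
    ⟪symOp A x, y⟫ = ⟪x, symOp A y⟫ := by
  conv_lhs => rw [← symOp_adjoint]
  exact ContinuousLinearMap.adjoint_inner_left _ _ _

lemma norm_symOp_le (A : Matrix (Fin d) (Fin d) ℝ) :
    ‖symOp A‖ ≤ ‖Matrix.toEuclideanCLM (𝕜 := ℝ) A‖ := by
  rw [symOp, norm_smul]
  have h := norm_add_le (Matrix.toEuclideanCLM (𝕜 := ℝ) A)
    (ContinuousLinearMap.adjoint (Matrix.toEuclideanCLM (𝕜 := ℝ) A))
  rw [LinearIsometryEquiv.norm_map] at h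
  norm_num
  linarith

lemma quadFeature_eq (A : Matrix (Fin d) (Fin d) ℝ) (x : EuclideanSpace ℝ (Fin d)) :
    quadFeature A x = ⟪x, symOp A x⟫ := by
  have h : quadFeature A x = ⟪x, Matrix.toEuclideanCLM (𝕜 := ℝ) A x⟫ := by
    rw [Matrix.inner_toEuclideanCLM, quadFeature, dotProduct_comm]
  rw [h, symOp]
  simp only [_root_.smul_apply, _root_.add_apply, inner_smul_right, inner_add_right,
    ContinuousLinearMap.adjoint_inner_right]
  rw [real_inner_comm x]
  ring

lemma linFeature_eq (u x : EuclideanSpace ℝ (Fin d)) : linFeature u x = ⟪u, x⟫ := by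
  rw [real_inner_comm]; rfl

namespace OrthogonalQuadraticFeatures

variable {r : ℕ} {A : Fin r → Matrix (Fin d) (Fin d) ℝ} {κ₁ : ℝ}

/-- For `d = 1` the sphere is `{±1}`, where a quadratic form is constant; it cannot have mean zero
and second moment one. -/
lemma two_le_dim (h : OrthogonalQuadraticFeatures A κ₁) (hd : 1 ≤ d) (i : Fin r) : 2 ≤ d := by
  by_contra hd2
  obtain rfl : d = 1 := by omega
  have := isProbabilityMeasure_unifSphere hd
  have hq : ∀ᵐ x ∂unifSphere 1, quadFeature (A i) x = A i 0 0 := by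
    filter_upwards [ae_norm_sq_unifSphere (d := 1)] with x hx
    have hx' : x.ofLp 0 * x.ofLp 0 = 1 := by
      rw [EuclideanSpace.real_norm_sq_eq] at hx
      simpa [sq] using hx
    have : quadFeature (A i) x = A i 0 0 * (x.ofLp 0 * x.ofLp 0) := by
      simp [quadFeature, dotProduct, Matrix.mulVec]; ring
    rw [this, hx', mul_one]
  have h0 := h.mean_zero i
  rw [integral_congr_ae hq] at h0
  have h1 := h.orthonormal i i
  rw [integral_congr_ae (hq.mono fun x hx => by rw [hx])] at h1
  simp at h0 h1
  simp [h0] at h1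

lemma opTrace_symOp (h : OrthogonalQuadraticFeatures A κ₁) (hd : 1 ≤ d) (i : Fin r) :
    opTrace (symOp (A i)) = 0 := by
  rw [← integral_quadForm_unifSphere hd, ← h.mean_zero i]
  simp only [quadFeature_eq]

lemma integral_sq (h : OrthogonalQuadraticFeatures A κ₁) (i : Fin r) :
    ∫ x, ⟪x, symOp (A i) x⟫ ^ 2 ∂unifSphere d = 1 := by
  have := h.orthonormal i i
  simpa only [quadFeature_eq, ← sq, if_true] using this

/-- Orthonormality read through the fourth-moment formula: the traces vanish, and the two remaining
terms coincide for symmetric operators. -/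
lemma opTrace_mul (h : OrthogonalQuadraticFeatures A κ₁) (hd : 1 ≤ d) (i j : Fin r) :
    2 * opTrace (symOp (A j) * symOp (A i)) = (if i = j then 1 else 0) * (1 + 2 / d) := by
  have hd0 : (d : ℝ) ≠ 0 := by positivity
  have h1 := integral_quadForm_mul_quadForm_unifSphere hd (symOp (A i)) (symOp (A j))
  have h2 := h.orthonormal i j
  simp only [quadFeature_eq] at h2
  rw [h2, h.opTrace_symOp hd, symOp_adjoint, opTrace_mul_comm (symOp (A i))] at h1
  field_simp
  linarith

lemma frobSq_symOp (h : OrthogonalQuadraticFeatures A κ₁) (hd : 1 ≤ d) (i : Fin r) :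
    2 * frobSq (symOp (A i)) = 1 + 2 / d := by
  rw [frobSq_eq_opTrace, symOp_adjoint, h.opTrace_mul hd]
  simp

lemma frobSq_symOp_le (h : OrthogonalQuadraticFeatures A κ₁) (hd : 1 ≤ d) (i : Fin r) :
    frobSq (symOp (A i)) ≤ 1 := by
  have h2 : (2 : ℝ) ≤ d := by exact_mod_cast h.two_le_dim hd i
  have h3 : 2 / (d : ℝ) ≤ 1 := by rw [div_le_one (by linarith)]; exact h2
  linarith [h.frobSq_symOp hd i]

lemma norm_symOp_le (h : OrthogonalQuadraticFeatures A κ₁) (i : Fin r) :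
    ‖symOp (A i)‖ ≤ κ₁ / Real.sqrt d :=
  (_root_.norm_symOp_le (A i)).trans (h.opNorm_le i)

/-- A normalised feature cannot have too small an operator norm: `1/2 ≤ ‖S‖_F² ≤ d ‖S‖² ≤ d ε²`.
Errors of order `1/d` are therefore dominated by `ε`. -/
lemma scale_pos (h : OrthogonalQuadraticFeatures A κ₁) (hd : 1 ≤ d) (i : Fin r) :
    0 < κ₁ / Real.sqrt d ∧ 1 / (d : ℝ) ≤ 2 * (κ₁ / Real.sqrt d) := by
  have hd1 : (1 : ℝ) ≤ d := by exact_mod_cast hd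
  set ε := κ₁ / Real.sqrt d
  have h1 : ‖symOp (A i)‖ ≤ ε := h.norm_symOp_le i
  have hε : 0 ≤ ε := (norm_nonneg _).trans h1
  have h2 := h.frobSq_symOp hd i
  have h3 := frobSq_le (symOp (A i))
  have h4 : ‖symOp (A i)‖ ^ 2 ≤ ε ^ 2 := pow_le_pow_left₀ (norm_nonneg _) h1 2
  have h5 : 1 ≤ 2 * (d * ε ^ 2) := by
    have : 0 ≤ 2 / (d : ℝ) := by positivity
    have : (d : ℝ) * ‖symOp (A i)‖ ^ 2 ≤ d * ε ^ 2 := by gcongr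
    linarith
  refine ⟨lt_of_le_of_ne hε fun h0 => ?_, ?_⟩
  · rw [← h0] at h5; norm_num at h5
  -- Compare squares: `(1/d)² ≤ 1/d ≤ 2ε² ≤ (2ε)²`.
  · refine (sq_le_sq₀ (by positivity) (by positivity)).1 ?_
    have ht : (1 : ℝ) / d ≤ 2 * ε ^ 2 := by
      rw [div_le_iff₀ (by positivity)]
      linarith
    have ht1 : (1 : ℝ) / d ≤ 1 := by rw [div_le_one (by positivity)]; exact hd1
    have ht2 : ((1 : ℝ) / d) ^ 2 ≤ 1 / d := by
      rw [sq]; exact mul_le_of_le_one_left (by positivity) ht1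
    nlinarith [sq_nonneg ε]

end OrthogonalQuadraticFeatures

end MatrixFeatures

/-! ### Assembly of the two bounds. -/

theorem mainTheorem6 :
    ∃ C : ℝ, 0 < C ∧
      ∀ (d r : ℕ) (κ₁ : ℝ) (A : Fin r → Matrix (Fin d) (Fin d) ℝ),
        1 ≤ d → 1 ≤ r → OrthogonalQuadraticFeatures A κ₁ →
        wasserstein1 ((unifSphere d).map (quadFeatures A))
            (stdGaussian (EuclideanSpace ℝ (Fin r)))
          ≤ ENNReal.ofReal (C * ((r : ℝ) ^ 2 * κ₁ / Real.sqrt d)) ∧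
        ∀ (s : ℕ) (u : Fin s → EuclideanSpace ℝ (Fin d)), Orthonormal ℝ u →
          wasserstein1 ((unifSphere d).map (quadLinFeatures A u))
              (stdGaussian (EuclideanSpace ℝ (Fin (r + s))))
            ≤ ENNReal.ofReal (C * (((r : ℝ) + (s : ℝ)) ^ 2 * κ₁ / Real.sqrt d)) := by
  -- `6π = (π/2) * 12`: the length of the path times the bound on each kernel entry in units of `ε`.
  refine ⟨6 * Real.pi, by positivity, fun d r κ₁ A hd hr h => ?_⟩
  -- A single quadratic feature already yields `2 ≤ d` and `1/d ≤ 2ε`, which the linear features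
  -- need as well.
  have i₀ : Fin r := ⟨0, hr⟩
  have hd2 : 2 ≤ d := h.two_le_dim hd i₀
  obtain ⟨hε, hdε⟩ := h.scale_pos hd i₀
  have hfield : ∀ i, IsSteinField (fun x => ⟪x, symOp (A i) x⟫) (quadField (symOp (A i))) :=
    fun i => isSteinField_quadField hd (h.opTrace_symOp hd i)
  have hqq : ∀ i j, ∫ x, |fderiv ℝ (fun x => ⟪x, symOp (A j) x⟫) x (quadField (symOp (A i)) x) -
      if i = j then 1 else 0| ∂unifSphere d ≤ 12 * (κ₁ / Real.sqrt d) := fun i j =>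
    integral_abs_fderiv_quad_quad_le hd2 (inner_symOp_left _) (h.norm_symOp_le j) hε hdε
      (h.integral_sq i) (h.integral_sq j) (h.frobSq_symOp_le hd i) (h.opTrace_mul hd i j)
      (by split_ifs <;> simp)
  refine ⟨?_, fun s u hu => ?_⟩
  · have hmap : quadFeatures A = fun x => WithLp.toLp 2 fun i => ⟪x, symOp (A i) x⟫ := by
      ext x i
      exact quadFeature_eq _ _
    rw [hmap]
    refine (wasserstein1_le_of_isSteinField hd hfield hqq).trans_eq ?_
    congr 1; ring
  · have hmap : quadLinFeatures A u = fun x => WithLp.toLp 2 fun i =>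
        (Fin.append (fun i x => ⟪x, symOp (A i) x⟫) (fun j x => ⟪u j, x⟫) :
          Fin (r + s) → EuclideanSpace ℝ (Fin d) → ℝ) i x := by
      ext x i
      refine Fin.addCases (fun i => ?_) (fun j => ?_) i
      · simp [quadLinFeatures, quadFeature_eq]
      · simp [quadLinFeatures, linFeature_eq]
    rw [hmap]
    refine (wasserstein1_le_of_isSteinField hd (V := Fin.append (fun i => quadField (symOp (A i)))
      fun j => linField (u j)) (B := 12 * (κ₁ / Real.sqrt d)) ?_ ?_).trans_eq ?_
    · refine Fin.addCases (fun i => ?_) (fun j => ?_)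
      · simpa only [Fin.append_left] using hfield i
      · simpa only [Fin.append_right] using isSteinField_linField hd2 (u j)
    · refine Fin.addCases (fun i => Fin.addCases (fun j => ?_) (fun j => ?_))
        (fun i => Fin.addCases (fun j => ?_) (fun j => ?_))
      · simpa only [Fin.append_left, (Fin.castAdd_injective r s).eq_iff] using hqq i j
      · have hne : Fin.castAdd s i ≠ Fin.natAdd r j := by
          intro h; have := congrArg Fin.val h; simp at this; omega
        simpa only [Fin.append_left, Fin.append_right, if_neg hne, sub_zero] using
          integral_abs_fderiv_lin_quad_le hd (inner_symOp_left _) (h.norm_symOp_le i) hε hdε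
            (h.integral_sq i) (hu.1 j)
      · have hne : Fin.natAdd r i ≠ Fin.castAdd s j := by
          intro h; have := congrArg Fin.val h; simp at this; omega
        simpa only [Fin.append_left, Fin.append_right, if_neg hne, sub_zero] using
          integral_abs_fderiv_quad_lin_le hd2 (inner_symOp_left _) (h.norm_symOp_le j) hε hdε
            (h.integral_sq j) (hu.1 i)
      · have hij := orthonormal_iff_ite.1 hu i j
        simpa only [Fin.append_right, (Fin.natAdd_injective s r).eq_iff, hij] using
          integral_abs_fderiv_lin_lin_le hd2 hε hdε (hu.1 i) (hu.1 j)
    · push_cast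
      congr 1; ring
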